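/- Let $k$ be an algebraically closed field. A variety is an integral scheme of finite type over $k$; it is normal if all its local rings are integrally closed, and "point" means closed point. A finite-Galois morphism $f:Y\to X$ of varieties is a finite dominant morphism over $k$ whose extension of function fields $k(Y)/k(X)$ is Galois; if $X,Y$ are normal, its Galois group $\mathrm{Gal}(f)$ is identified with the group $\mathrm{Aut}_X(Y)$ of automorphisms of $Y$ over $X$. A finite surjective morphism $f:Y\to X$ of varieties is genuinely ramified if it is étale over a non-empty open subset of $X$ and if, for every factorization $Y\to X'\xrightarrow{u}X$ of $f$ into morphisms of varieties with $u$ étale and separated, $u$ is an isomorphism. Lemma. Let $f:Y\to X$ be a finite-Galois morphism between normal varieties over $k$, and let $I\subseteq\mathrm{Gal}(f)$ be the subgroup generated by all elements fixing at least one point of $Y$. 1. If $I=\mathrm{Gal}(f)$, then $f$ is genuinely ramified. 2. The subgroup $I$ is normal in $\mathrm{Gal}(f)$, and the quotient $\chi:Y\to M$ of $Y$ by $I$ exists, i.e. $M$ is the topological quotient of $Y$ by $I$ and $\mathcal O_M=(\chi_*\mathcal O_Y)^I$. For this quotient there is a unique morphism $u:M\to X$ with $u\circ\chi=f$; $M$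 is a variety, $\chi$ is genuinely ramified and $u$ is étale. 3. If $f$ is genuinely ramified, then $I=\mathrm{Gal}(f)$. -/

import Mathlib

universe u

open AlgebraicGeometry CategoryTheory

namespace QuotVar

/-- A variety over a field `k`: an integral scheme of finite type over `k`. -/
structure IsVariety {k : Type u} [Field k] {X : Scheme.{u}}
    (p : X ⟶ Spec (CommRingCat.of k)) : Prop where
  isIntegral : IsIntegral X
  locallyOfFiniteType : LocallyOfFiniteType p
  quasiCompact : QuasiCompact p

/-- A scheme is normal if all its local rings are integrally closed domains. -/
def IsNormal (X : Scheme.{u}) : Prop :=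
  ∀ x : X, IsDomain (X.presheaf.stalk x) ∧ IsIntegrallyClosed (X.presheaf.stalk x)

/-- A dominant morphism of integral schemes maps the generic point to the generic point. -/
theorem specializes_genericPoint {X Y : Scheme.{u}} [IsIntegral X] [IsIntegral Y]
    (f : Y ⟶ X) [IsDominant f] : f (genericPoint Y) ⤳ genericPoint X := by
  have h : IsGenericPoint (f (genericPoint Y)) ⊤ := by
    have h1 := (genericPoint_spec Y).image f.continuous
    rw [Set.image_univ, f.denseRange.closure_range] at h1
    exact h1
  exact h.specializes trivial

/-- The homomorphism of function fields `k(X) ⟶ k(Y)` given by a dominant morphism `Y ⟶ X`. -/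
noncomputable def functionFieldMap {X Y : Scheme.{u}} [IsIntegral X] [IsIntegral Y]
    (f : Y ⟶ X) [IsDominant f] : X.functionField ⟶ Y.functionField :=
  X.presheaf.stalkSpecializes (specializes_genericPoint f) ≫ f.stalkMap (genericPoint Y)

/-- A finite-Galois morphism of integral schemes: a finite dominant morphism whose extension of
function fields is Galois. -/
structure IsFiniteGalois {X Y : Scheme.{u}} (f : Y ⟶ X) : Prop where
  [isIntegral_target : IsIntegral X]
  [isIntegral_source : IsIntegral Y]
  [isDominant : IsDominant f]
  isFinite : IsFinite f
  isGalois :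
    letI : Algebra X.functionField Y.functionField := (functionFieldMap f).hom.toAlgebra
    IsGalois X.functionField Y.functionField

/-- The group `Gal(f) = Aut_X(Y)` of automorphisms of `Y` over `X`. For a finite-Galois morphism
of normal varieties it is the Galois group of the extension of function fields. -/
abbrev Gal {X Y : Scheme.{u}} (f : Y ⟶ X) : Type u := Aut (Over.mk f)

/-- The morphism of schemes `Y ⟶ Y` underlying an element of `Gal(f)`. -/
def Gal.toHom {X Y : Scheme.{u}} {f : Y ⟶ X} (g : Gal f) : Y ⟶ Y := g.hom.left

/-- `g` fixes at least one point, where a point of a variety means a *closed* point. -/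
def HasFixedPoint {X Y : Scheme.{u}} {f : Y ⟶ X} (g : Gal f) : Prop :=
  ∃ y : Y, IsClosed ({y} : Set Y) ∧ Gal.toHom g y = y

/-- The subgroup of `Gal(f)` generated by all elements fixing at least one point. -/
def fixSubgroup {X Y : Scheme.{u}} (f : Y ⟶ X) : Subgroup (Gal f) :=
  Subgroup.closure {g | HasFixedPoint g}

theorem preimage_le {Y M : Scheme.{u}} {χ : Y ⟶ M} {g : Y ⟶ Y} (h : g ≫ χ = χ) (U : M.Opens) :
    χ ⁻¹ᵁ U ≤ g ⁻¹ᵁ χ ⁻¹ᵁ U := by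
  rw [← Scheme.Hom.comp_preimage, h]

/-- `χ : Y ⟶ M` is the quotient of `Y` by the group `H` of automorphisms of `Y`:
it is the quotient by `H` on topological spaces, and `𝒪_M` is the sheaf `(χ_* 𝒪_Y)^H` of
`H`-invariant functions. -/
structure IsQuotientBy {X Y M : Scheme.{u}} {f : Y ⟶ X} (H : Subgroup (Gal f))
    (χ : Y ⟶ M) : Prop where
  invariant : ∀ g ∈ H, Gal.toHom g ≫ χ = χ
  isQuotientMap : Topology.IsQuotientMap χ
  exists_of_eq : ∀ y y' : Y, χ y = χ y' → ∃ g ∈ H, Gal.toHom g y = y'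
  app_injective : ∀ U : M.Opens, Function.Injective (χ.app U)
  exists_app_eq : ∀ (U : M.Opens) (s : Γ(Y, χ ⁻¹ᵁ U)),
    (∀ (g : Gal f) (hg : g ∈ H),
      (Gal.toHom g).appLE (χ ⁻¹ᵁ U) (χ ⁻¹ᵁ U) (preimage_le (invariant g hg) U) s = s) →
    ∃ t : Γ(M, U), χ.app U t = s

/-- A genuinely ramified morphism `f : Y ⟶ X` of `k`-varieties (where `Y` has the structure
morphism `f ≫ p`): it is finite, surjective, generically étale, and in every factorization
`Y ⟶ X' ⟶ X` through a `k`-variety `X'` with `u : X' ⟶ X` étale, `u` is an isomorphism.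
An étale covering `u` is understood to be separated; if `X` is separated over `k`, this says
exactly that `X'` is separated over `k`. (Without it, not even the identity of the affine line
would be genuinely ramified, because of the affine line with a doubled origin.) -/
structure IsGenuinelyRamified {k : Type u} [Field k] {X Y : Scheme.{u}}
    (p : X ⟶ Spec (CommRingCat.of k)) (f : Y ⟶ X) : Prop where
  isFinite : IsFinite f
  surjective : Surjective f
  generically_etale : ∃ U : X.Opens, (U : Set X).Nonempty ∧ Etale (f ∣_ U)
  isIso_of_factorization : ∀ (X' : Scheme.{u}) (g : Y ⟶ X') (u : X' ⟶ X),
    IsVariety (u ≫ p) → IsSeparated u → Etale u → g ≫ u = f → IsIso u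

end QuotVar

/-! Write `G = Gal(f)`, a finite group, and `I = fixSubgroup f`. It is normal because conjugates of
elements with fixed points again have fixed points. The argument rests on four facts.

Since `X` and `Y` are normal, `X` is the quotient of `Y` by `G` (`isQuotientBy_gal`): automorphisms
of `k(Y)` over `k(X)` extend to `Y`, so an invariant function lies in `k(X)`, is integral over the
functions on `X`, and hence is a function on `X`.

For every subgroup `H` of `G` the quotient exists, as the relative spectrum over `X` of the
`H`-invariants of the direct image of the structure sheaf of `Y` (`isQuotientBy_toQuotient`). It is
a categorical quotient (`IsQuotientBy.exists_desc`), hence unique.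

The quotient `M` of `Y` by `I` is étale over `X` (`etale_quotientToBase`). Indeed `G/I` acts on `M`
with quotient `X`, and freely on closed points: if `g` fixes the image of `y`, then `g i` fixes a
closed point of `Y` for some `i` in `I`, so `g` lies in `I`. A free action of a finite group has
étale quotient (`etale_of_isInvariant_of_free`), by the Galois theory of rings of Chase, Harrison
and Rosenberg.

Finally, `Y → M` factors through no nontrivial separated étale covering `X' → M`
(`isIso_of_isQuotientBy_fixSubgroup`). If `σ` fixes a `k`-point, then `Y → X'` and its composite
with `σ` are lifts of the same map that agree at a point, so they are equal. Thus `Y → X'` is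
`I`-invariant and descends to a section of `X' → M`, which forces an isomorphism.

When `I = G`, `M` is `X`, which gives the first claim. Conversely, if `f` is genuinely ramified, the
étale map `M → X` is an isomorphism, so `I`-orbits and `G`-orbits coincide; comparing them at one
closed point gives `I = G`. -/

namespace QuotVar

/-! ### Free actions of finite groups on rings are étale over the invariants. -/

section FreeAction

open TensorProduct Pointwise

variable {A C N : Type*} [CommRing A] [CommRing C] [Algebra A C] [Group N]
  [MulSemiringAction N C] [SMulCommClass N A C]

variable (A C) in
/-- The algebra homomorphism `x ⊗ y ↦ x * σ y`. -/
noncomputable def twistedMul (σ : N) : C ⊗[A] C →ₐ[C] C :=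
  Algebra.TensorProduct.lift (AlgHom.id C C) (MulSemiringAction.toAlgHom A C σ)
    fun _ _ ↦ .all _ _

@[simp]
theorem twistedMul_tmul (σ : N) (x y : C) : twistedMul A C σ (x ⊗ₜ y) = x * σ • y := by
  simp [twistedMul]

/-- The tensor `(σ c) ⊗ 1 - 1 ⊗ c` is killed by the `σ`-twisted multiplication, and ordinary
multiplication sends it to `σ c - c`. By freeness the image of the kernel lies in no maximal ideal,
so it contains `1`. -/
theorem exists_twistedMul_eq_zero (σ : N)
    (h : ∀ m : Ideal C, m.IsMaximal → ∃ c : C, σ • c - c ∉ m) :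
    ∃ t : C ⊗[A] C, twistedMul A C (1 : N) t = 1 ∧ twistedMul A C σ t = 0 := by
  let J : Ideal C := (RingHom.ker (twistedMul A C σ)).map (twistedMul A C (1 : N)).toRingHom
  have hs : Function.Surjective (twistedMul A C (1 : N)).toRingHom :=
    fun c ↦ ⟨c ⊗ₜ 1, by simp⟩
  have hJ : J = ⊤ := by
    by_contra hne
    obtain ⟨m, hm, hJm⟩ := J.exists_le_maximal hne
    obtain ⟨c, hc⟩ := h m hm
    refine hc (hJm ?_)
    have : (twistedMul A C (1 : N)).toRingHom ((σ • c) ⊗ₜ 1 - 1 ⊗ₜ c) = σ • c - c := by simp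
    rw [← this]
    exact Ideal.mem_map_of_mem _ (by simp [RingHom.mem_ker])
  obtain ⟨t, ht, h1⟩ := (Ideal.mem_map_iff_of_surjective _ hs).mp
    (show (1 : C) ∈ J by rw [hJ]; trivial)
  exact ⟨t, h1, ht⟩

/-- The product of the elements separating `1` from each `σ ≠ 1`. Geometrically it is the function
equal to `1` on the diagonal and `0` on the graph of every other group element. -/
theorem exists_separability_element [Finite N]
    (h : ∀ σ : N, σ ≠ 1 → ∀ m : Ideal C, m.IsMaximal → ∃ c : C, σ • c - c ∉ m) :
    ∃ e : C ⊗[A] C, twistedMul A C (1 : N) e = 1 ∧ ∀ σ : N, σ ≠ 1 → twistedMul A C σ e = 0 := by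
  classical
  cases nonempty_fintype N
  choose t ht1 ht using fun σ hσ ↦ exists_twistedMul_eq_zero (A := A) σ (h σ hσ)
  refine ⟨∏ σ : N, if hσ : σ ≠ 1 then t σ hσ else 1, ?_, fun σ hσ ↦ ?_⟩
  · rw [map_prod]
    refine Finset.prod_eq_one fun σ _ ↦ ?_
    split_ifs with hσ
    · exact ht1 σ hσ
    · exact map_one _
  · rw [map_prod]
    refine Finset.prod_eq_zero (Finset.mem_univ σ) ?_
    rw [dif_pos hσ]
    exact ht σ hσ

/-- If a finite group acts on `C` with ring of invariants `A` and acts freely on the maximal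
spectrum in the strong sense, then `C` is étale over `A`. -/
theorem etale_of_isInvariant_of_free [Finite N] [Algebra.IsInvariant A C N]
    (hinj : Function.Injective (algebraMap A C))
    (h : ∀ σ : N, σ ≠ 1 → ∀ m : Ideal C, m.IsMaximal → ∃ c : C, σ • c - c ∉ m) :
    Algebra.Etale A C := by
  classical
  cases nonempty_fintype N
  obtain ⟨e, he1, he⟩ := exists_separability_element (A := A) h
  obtain ⟨S, hS⟩ := TensorProduct.exists_finset e
  have key (σ : N) : ∑ p ∈ S, p.1 * σ • p.2 = if σ = 1 then 1 else 0 := by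
    have : twistedMul A C σ e = ∑ p ∈ S, p.1 * σ • p.2 := by simp [hS]
    rw [← this]
    split_ifs with hσ
    · rw [hσ, he1]
    · exact he σ hσ
  have htr (c : C) : ∃ a : A, algebraMap A C a = ∑ σ : N, σ • c := by
    refine Algebra.IsInvariant.isInvariant (G := N) _ fun g ↦ ?_
    rw [Finset.smul_sum]
    simp_rw [smul_smul]
    exact Fintype.sum_equiv (Equiv.mulLeft g) _ _ fun _ ↦ rfl
  choose T hT using htr
  let tr : C →ₗ[A] A :=
    { toFun := T
      map_add' := fun x y ↦ hinj (by simp [hT, Finset.sum_add_distrib])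
      map_smul' := fun a x ↦ hinj (by
        simp only [hT, smul_comm _ a x, RingHom.id_apply, smul_eq_mul, map_mul]
        rw [← Finset.smul_sum, Algebra.smul_def]) }
  have htr (c : C) : algebraMap A C (tr c) = ∑ σ : N, σ • c := hT c
  -- By the orthogonality relations `key`, only `σ = 1` survives in the expanded trace. This is a
  -- dual basis for `C`, so `C` is finite projective over `A`.
  have hbasis (c : C) : ∑ p ∈ S, tr (p.2 * c) • p.1 = c := by
    simp_rw [Algebra.smul_def, htr, smul_mul', Finset.sum_mul]
    rw [Finset.sum_comm]
    calc _ = ∑ σ : N, (∑ p ∈ S, p.1 * σ • p.2) * σ • c := by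
          refine Finset.sum_congr rfl fun σ _ ↦ ?_
          rw [Finset.sum_mul]
          exact Finset.sum_congr rfl fun p _ ↦ by ring
      _ = c := by simp [key]
  have hfin : Module.Finite A C := by
    refine ⟨⟨S.image Prod.fst, top_unique fun c _ ↦ ?_⟩⟩
    rw [← hbasis c]
    exact Submodule.sum_mem _ fun p hp ↦ Submodule.smul_mem _ _
      (Submodule.subset_span (Finset.mem_coe.mpr (Finset.mem_image_of_mem _ hp)))
  have hproj : Module.Projective A C := by
    refine Module.Projective.of_split (M := S → A)
      (LinearMap.pi fun p ↦ tr ∘ₗ LinearMap.mulLeft A p.1.2)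
      (∑ p : S, (LinearMap.toSpanSingleton A C p.1.1) ∘ₗ LinearMap.proj p) ?_
    ext c
    conv_rhs => rw [LinearMap.id_apply, ← hbasis c, ← Finset.sum_coe_sort]
    simp
  have hfp := Module.finitePresentation_of_projective A C
  -- A tensor is recovered from its images under all twisted multiplications, so vanishing in `C ⊗
  -- C` can be tested there. This shows that `e` annihilates every `1 ⊗ s - s ⊗ 1`.
  have hdecomp (t : C ⊗[A] C) :
      t = ∑ p ∈ S, (∑ σ : N, twistedMul A C σ t * σ • p.2) ⊗ₜ p.1 := by
    induction t with
    | zero => simp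
    | tmul u v =>
      conv_lhs => rw [← hbasis v]
      rw [TensorProduct.tmul_sum]
      refine Finset.sum_congr rfl fun p _ ↦ ?_
      rw [← TensorProduct.smul_tmul, Algebra.smul_def, htr]
      simp_rw [smul_mul', twistedMul_tmul]
      congr 1
      rw [Finset.sum_mul]
      exact Finset.sum_congr rfl fun σ _ ↦ by ring
    | add x y hx hy =>
      conv_lhs => rw [hx, hy]
      simp_rw [map_add, add_mul, Finset.sum_add_distrib, TensorProduct.add_tmul,
        Finset.sum_add_distrib]
  have hur : Algebra.FormallyUnramified A C := by
    refine Algebra.FormallyUnramified.iff_exists_tensorProduct.mpr ⟨e, fun s ↦ ?_, ?_⟩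
    · rw [hdecomp ((1 ⊗ₜ s - s ⊗ₜ 1) * e)]
      refine Finset.sum_eq_zero fun p _ ↦ ?_
      rw [Finset.sum_eq_zero, TensorProduct.zero_tmul]
      intro σ _
      by_cases hσ : σ = 1
      · simp [hσ]
      · simp [he σ hσ]
    · rw [← he1]
      have : Algebra.TensorProduct.lmul' A (S := C) =
          (twistedMul A C (1 : N)).restrictScalars A := by
        ext <;> simp
      rw [this]
      rfl
  exact Algebra.Etale.of_formallyUnramified_of_flat

/-- Let a finite group `G` act on `B` with invariants `A`, and let `H` be a normal subgroup
containing the stabilizers of all maximal ideals. Then the ring of `H`-invariants is étale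
over `A`. -/
theorem etale_fixedPoints {B G : Type*} [CommRing B] [Algebra A B] [Group G] [Finite G]
    [MulSemiringAction G B] [SMulCommClass G A B] [Algebra.IsInvariant A B G]
    (H : Subgroup G) [H.Normal] (hinj : Function.Injective (algebraMap A B))
    (h : ∀ (g : G) (n : Ideal B), n.IsMaximal → (∀ b, g • b ∈ n ↔ b ∈ n) → g ∈ H) :
    Algebra.Etale A (FixedPoints.subalgebra A B H) := by
  have hinv : Algebra.IsInvariant (FixedPoints.subalgebra A B H) B H :=
    ⟨fun b hb ↦ ⟨⟨b, hb⟩, rfl⟩⟩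
  have hcomm : SMulCommClass H (FixedPoints.subalgebra A B H) B := by
    refine ⟨fun g c b ↦ ?_⟩
    change g • (c.1 * b) = c.1 * g • b
    rw [smul_mul', c.2 g]
  have hint := hinv.isIntegral
  refine etale_of_isInvariant_of_free (N := G ⧸ H)
    (fun a b hab ↦ hinj (congr_arg Subtype.val hab)) fun σ hσ m hm ↦ ?_
  obtain ⟨g, rfl⟩ := QuotientGroup.mk_surjective σ
  by_contra! hc
  obtain ⟨n, hn, hnm⟩ := Ideal.exists_ideal_over_maximal_of_isIntegral
    (S := B) m (by
      rw [(RingHom.injective_iff_ker_eq_bot _).mp Subtype.val_injective]; exact bot_le)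
  have hc' (c : FixedPoints.subalgebra A B H) : g • c.1 ∈ n ↔ c.1 ∈ n := by
    have h1 : (⟨g • c.1, (((g : G ⧸ H) • c).2)⟩ : FixedPoints.subalgebra A B H) - c ∈ m := hc c
    rw [← hnm] at h1
    have h2 : g • c.1 - c.1 ∈ n := h1
    exact ⟨fun h ↦ by simpa using n.sub_mem h h2, fun h ↦ by simpa using n.add_mem h2 h⟩
  -- `n' = g⁻¹ n` lies over the same ideal of the `H`-invariants as `n`, because `g` acts trivially
  -- modulo `m`. As `H` is transitive on the primes over a given one, some `i` in `H` makes `g i`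
  -- stabilize `n`.
  let n' : Ideal B := n.comap (MulSemiringAction.toRingHom G B g)
  have hn' : n'.IsPrime := Ideal.comap_isPrime _ _
  obtain ⟨i, hi⟩ := Algebra.IsInvariant.exists_smul_of_under_eq
    (FixedPoints.subalgebra A B H) B H n n' (by
      ext c
      exact (hc' c).symm)
  have hmem (b : B) : g • b ∈ n ↔ (i : G)⁻¹ • b ∈ n := by
    exact (SetLike.ext_iff.mp hi b).trans Ideal.mem_pointwise_smul_iff_inv_smul_mem
  refine hσ ((QuotientGroup.eq_one_iff g).mpr ?_)
  have := h (g * i) n hn fun b ↦ by rw [mul_smul, hmem]; simp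
  exact (H.mul_mem_cancel_right i.2).mp this

end FreeAction

/-! ### Localization away from an element and invariants. -/

section Localization

variable {A A' B B' : Type*} [CommRing A] [CommRing A'] [CommRing B] [CommRing B']

/-- `ρ : A → A'` exhibits `A'` as the localization of `A` away from `r`, in elementary terms. -/
structure IsAwayMap (ρ : A →+* A') (r : A) : Prop where
  isUnit : IsUnit (ρ r)
  surj : ∀ t : A', ∃ (n : ℕ) (a : A), t * ρ r ^ n = ρ a
  ker : ∀ a : A, ρ a = 0 → ∃ n : ℕ, r ^ n * a = 0

theorem isAwayMap_of_isLocalization [Algebra A A'] (r : A) [IsLocalization.Away r A'] :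
    IsAwayMap (algebraMap A A') r where
  isUnit := IsLocalization.Away.algebraMap_isUnit r
  surj t := by
    obtain ⟨n, a, h⟩ := IsLocalization.Away.surj r t
    exact ⟨n, a, h⟩
  ker a ha := by
    obtain ⟨⟨_, n, rfl⟩, h⟩ := (IsLocalization.map_eq_zero_iff (.powers r) A' a).mp ha
    exact ⟨n, h⟩

theorem IsAwayMap.isLocalization [Algebra A A'] {r : A} (h : IsAwayMap (algebraMap A A') r) :
    IsLocalization.Away r A' := by
  refine ⟨?_, fun t ↦ ?_, fun {x y} hxy ↦ ?_⟩
  · rintro ⟨_, n, rfl⟩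
    simpa using h.isUnit.pow n
  · obtain ⟨n, a, ha⟩ := h.surj t
    exact ⟨(a, ⟨r ^ n, n, rfl⟩), by simpa using ha⟩
  · obtain ⟨n, hn⟩ := h.ker (x - y) (by simp [hxy])
    exact ⟨⟨r ^ n, n, rfl⟩, by simpa [mul_sub, sub_eq_zero] using hn⟩

theorem IsAwayMap.injective {ρ : A →+* A'} {ρ' : B →+* B'} {φ : A →+* B} {φ' : A' →+* B'} {r : A}
    (h : IsAwayMap ρ r) (h' : IsAwayMap ρ' (φ r)) (comm : ∀ a, ρ' (φ a) = φ' (ρ a))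
    (hφ : Function.Injective φ) : Function.Injective φ' := by
  rw [injective_iff_map_eq_zero] at hφ ⊢
  intro t ht
  obtain ⟨n, a, ha⟩ := h.surj t
  obtain ⟨m, hm⟩ := h'.ker (φ a) (by rw [comm, ← ha, map_mul, ht, zero_mul])
  have h0 : ρ (r ^ m * a) = 0 := by
    rw [hφ (r ^ m * a) (by simpa using hm), map_zero]
  have hu := (h.isUnit.pow m).mul (h.isUnit.pow n)
  refine (hu.mul_left_eq_zero).mp ?_
  rw [← h0, map_mul, map_pow, ← ha]
  ring

/-- Invariants commute with localization at an invariant element: the finitely many equations `γ i b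
= b` all hold after multiplication by one common power of `r`. -/
theorem IsAwayMap.exists_fixed {ι : Type*} [Finite ι] {ρ : B →+* B'} {r : B}
    {γ : ι → B →+* B} {γ' : ι → B' →+* B'} (h : IsAwayMap ρ r)
    (comm : ∀ i b, ρ (γ i b) = γ' i (ρ b)) (hr : ∀ i, γ i r = r) (s : B')
    (hs : ∀ i, γ' i s = s) :
    ∃ (n : ℕ) (b : B), (∀ i, γ i b = b) ∧ s * ρ r ^ n = ρ b := by
  classical
  cases nonempty_fintype ι
  obtain ⟨n, b, hb⟩ := h.surj s
  have hfix (i : ι) : ρ (γ i b - b) = 0 := by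
    rw [map_sub, comm, ← hb, map_mul, map_pow, hs, ← comm, hr, sub_self]
  choose m hm using fun i ↦ h.ker _ (hfix i)
  refine ⟨n + ∑ i, m i, r ^ (∑ i, m i) * b, fun i ↦ ?_, ?_⟩
  · rw [map_mul, map_pow, hr, ← sub_eq_zero, ← mul_sub,
      ← Finset.add_sum_erase _ _ (Finset.mem_univ i), pow_add, mul_right_comm, hm, zero_mul]
  · rw [map_mul, map_pow, ← hb, pow_add]
    ring

end Localization

/-! ### Functions on open sets and the action of automorphisms on them. -/

section Sections

variable {X : Scheme.{u}}

theorem isAwayMap_basicOpen {U : X.Opens} (hU : IsAffineOpen U) (r : Γ(X, U)) {V : X.Opens}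
    (hV : V = X.basicOpen r) (i : V ≤ U) :
    IsAwayMap (X.presheaf.map (homOfLE i).op).hom r := by
  subst hV
  have := hU.isLocalization_basicOpen r
  exact isAwayMap_of_isLocalization (A' := Γ(X, X.basicOpen r)) r

theorem isAwayMap_app_basicOpen {Y : Scheme.{u}} (f : Y ⟶ X) {U : X.Opens}
    (hU : IsAffineOpen (f ⁻¹ᵁ U)) (r : Γ(X, U)) (i : f ⁻¹ᵁ X.basicOpen r ≤ f ⁻¹ᵁ U) :
    IsAwayMap (Y.presheaf.map (homOfLE i).op).hom ((f.app U).hom r) :=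
  isAwayMap_basicOpen hU _ (Scheme.preimage_basicOpen f r) i

end Sections

section Pull

variable {Y M : Scheme.{u}} {χ : Y ⟶ M} {σ τ : Y ⟶ Y}

/-- The action of an endomorphism of `Y` over `M` on functions. -/
def pull (h : σ ≫ χ = χ) (U : M.Opens) : Γ(Y, χ ⁻¹ᵁ U) ⟶ Γ(Y, χ ⁻¹ᵁ U) :=
  σ.appLE (χ ⁻¹ᵁ U) (χ ⁻¹ᵁ U) (preimage_le h U)

@[simp]
theorem app_pull (h : σ ≫ χ = χ) (U : M.Opens) : χ.app U ≫ pull h U = χ.app U := by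
  simp only [pull, Scheme.Hom.app_eq_appLE, Scheme.Hom.appLE_comp_appLE, h]

@[simp]
theorem pull_app_apply (h : σ ≫ χ = χ) (U : M.Opens) (t : Γ(M, U)) :
    pull h U (χ.app U t) = χ.app U t := by
  rw [← CommRingCat.comp_apply, app_pull]

theorem map_pull (h : σ ≫ χ = χ) {U V : M.Opens} (i : V ≤ U) (s : Γ(Y, χ ⁻¹ᵁ U)) :
    pull h V (Y.presheaf.map (homOfLE (χ.preimage_mono i)).op s) =
      Y.presheaf.map (homOfLE (χ.preimage_mono i)).op (pull h U s) := by
  simp only [pull, ← CommRingCat.comp_apply, Scheme.Hom.appLE_map, Scheme.Hom.map_appLE]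

theorem pull_pull (h : σ ≫ χ = χ) (h' : τ ≫ χ = χ) (U : M.Opens) (s : Γ(Y, χ ⁻¹ᵁ U)) :
    pull h U (pull h' U s) = pull (σ := σ ≫ τ) (by rw [Category.assoc, h', h]) U s := by
  simp only [pull, ← CommRingCat.comp_apply, Scheme.Hom.appLE_comp_appLE]

theorem pull_id (U : M.Opens) (s : Γ(Y, χ ⁻¹ᵁ U)) :
    pull (σ := 𝟙 Y) (Category.id_comp χ) U s = s := by
  change Y.presheaf.map (𝟙 _) s = s
  rw [Y.presheaf.map_id]
  rfl

theorem map_app_apply (χ : Y ⟶ M) {U V : M.Opens} (i : V ≤ U) (s : Γ(M, U)) :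
    χ.app V (M.presheaf.map (homOfLE i).op s) =
      Y.presheaf.map (homOfLE (χ.preimage_mono i)).op (χ.app U s) := by
  simp only [Scheme.Hom.app_eq_appLE, ← CommRingCat.comp_apply, Scheme.Hom.appLE_map,
    Scheme.Hom.map_appLE]

end Pull

section Gal

variable {X Y : Scheme.{u}} {f : Y ⟶ X}

@[simp]
theorem Gal.toHom_comp (g : Gal f) : Gal.toHom g ≫ f = f := Over.w g.hom

theorem Gal.toHom_mul (g h : Gal f) : Gal.toHom (g * h) = Gal.toHom h ≫ Gal.toHom g := rfl

theorem Gal.toHom_one : Gal.toHom (1 : Gal f) = 𝟙 Y := rfl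

theorem Gal.toHom_inv_comp (g : Gal f) : Gal.toHom g⁻¹ ≫ Gal.toHom g = 𝟙 Y := by
  rw [← Gal.toHom_mul, mul_inv_cancel, Gal.toHom_one]

theorem Gal.toHom_comp_inv (g : Gal f) : Gal.toHom g ≫ Gal.toHom g⁻¹ = 𝟙 Y := by
  rw [← Gal.toHom_mul, inv_mul_cancel, Gal.toHom_one]

instance (g : Gal f) : IsIso (Gal.toHom g) :=
  ⟨Gal.toHom g⁻¹, Gal.toHom_comp_inv g, Gal.toHom_inv_comp g⟩

theorem Gal.ext_toHom {g h : Gal f} (e : Gal.toHom g = Gal.toHom h) : g = h :=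
  Aut.ext (Over.OverMorphism.ext e)

/-- The action of a group of automorphisms of `Y` over `M` on functions. -/
abbrev sectionsAction {P : Type*} [Group P] (φ : P →* Gal f) {M : Scheme.{u}} {χ : Y ⟶ M}
    (inv : ∀ p, Gal.toHom (φ p) ≫ χ = χ) (U : M.Opens) :
    MulSemiringAction P Γ(Y, χ ⁻¹ᵁ U) where
  -- Pullback of functions reverses composition; the inverse turns it into a left action.
  smul p s := pull (inv p⁻¹) U s
  one_smul s := by
    change pull _ U s = s
    convert pull_id (χ := χ) U s
    rw [inv_one, map_one]; rfl
  mul_smul p q s := by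
    change pull _ U s = pull _ U (pull _ U s)
    rw [pull_pull]
    congr
    rw [mul_inv_rev, map_mul, Gal.toHom_mul]
  smul_zero p := map_zero (pull _ U).hom
  smul_add p := map_add (pull _ U).hom
  smul_one p := map_one (pull _ U).hom
  smul_mul p := map_mul (pull _ U).hom

end Gal

/-! ### Recognizing a quotient on an affine cover. -/

section Criterion

variable {X Y M : Scheme.{u}} {f : Y ⟶ X} {H : Subgroup (Gal f)} {χ : Y ⟶ M}

/-- The sections of `M` over `U` are the `H`-invariant functions on `χ ⁻¹ U`. -/
structure IsInvariantsOn (inv : ∀ g ∈ H, Gal.toHom g ≫ χ = χ) (U : M.Opens) : Prop where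
  injective : Function.Injective (χ.app U)
  exists_eq : ∀ s : Γ(Y, χ ⁻¹ᵁ U), (∀ (g : Gal f) (hg : g ∈ H), pull (inv g hg) U s = s) →
    ∃ t : Γ(M, U), χ.app U t = s

variable {inv : ∀ g ∈ H, Gal.toHom g ≫ χ = χ}

theorem IsInvariantsOn.basicOpen [Finite H] {U : M.Opens} (h : IsInvariantsOn inv U)
    (hU : IsAffineOpen U) (hU' : IsAffineOpen (χ ⁻¹ᵁ U)) (r : Γ(M, U)) :
    IsInvariantsOn inv (M.basicOpen r) := by
  have hle := M.basicOpen_le r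
  have hA := isAwayMap_basicOpen hU r rfl hle
  have hB := isAwayMap_app_basicOpen χ hU' r (χ.preimage_mono hle)
  have comm (a : Γ(M, U)) := (map_app_apply χ hle a).symm
  refine ⟨hA.injective hB (φ' := (χ.app _).hom) comm h.injective, fun s hs ↦ ?_⟩
  obtain ⟨n, b, hb, hsb⟩ := hB.exists_fixed (ι := H)
    (γ := fun g ↦ (pull (inv g g.2) U).hom) (γ' := fun g ↦ (pull (inv g g.2) (M.basicOpen r)).hom)
    (fun g b ↦ (map_pull (inv g g.2) hle b).symm) (fun g ↦ pull_app_apply (inv g g.2) U r) s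
    (fun g ↦ hs g g.2)
  obtain ⟨a, rfl⟩ := h.exists_eq b fun g hg ↦ hb ⟨g, hg⟩
  obtain ⟨v, hv⟩ := (hA.isUnit.pow n).exists_left_inv
  refine ⟨v * M.presheaf.map (homOfLE hle).op a, ?_⟩
  have hsb' : s * (Y.presheaf.map (homOfLE (χ.preimage_mono hle)).op (χ.app U r)) ^ n =
      Y.presheaf.map (homOfLE (χ.preimage_mono hle)).op (χ.app U a) := hsb
  rw [← map_app_apply χ hle, ← map_app_apply χ hle] at hsb'
  rw [map_mul, ← hsb', ← map_pow, mul_left_comm, ← map_mul]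
  have hv' : v * (M.presheaf.map (homOfLE hle).op r) ^ n = 1 := hv
  rw [hv', map_one, mul_one]

/-- Both conditions are local by the sheaf property. Injectivity comes first, since it makes the
local preimages of an invariant function agree on overlaps. -/
theorem isInvariantsOn_of_basis
    (hb : ∀ (V : M.Opens) (m : M), m ∈ V → ∃ D ≤ V, m ∈ D ∧ IsInvariantsOn inv D)
    (V : M.Opens) : IsInvariantsOn inv V := by
  have hinj (V : M.Opens) : Function.Injective (χ.app V) := by
    intro s t hst
    choose D hDV hmD hD using fun m : V ↦ hb V m m.2
    refine M.sheaf.eq_of_locally_eq' D V (fun m ↦ homOfLE (hDV m))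
      (fun m hm ↦ TopologicalSpace.Opens.mem_iSup.mpr ⟨⟨m, hm⟩, hmD ⟨m, hm⟩⟩) s t fun m ↦ ?_
    refine (hD m).injective ?_
    exact (map_app_apply χ (hDV m) s).trans
      ((congr_arg _ hst).trans (map_app_apply χ (hDV m) t).symm)
  refine ⟨hinj V, fun s hs ↦ ?_⟩
  choose D hDV hmD hD using fun m : V ↦ hb V m m.2
  have hcov : V ≤ iSup D :=
    fun m hm ↦ TopologicalSpace.Opens.mem_iSup.mpr ⟨⟨m, hm⟩, hmD ⟨m, hm⟩⟩
  have hloc (m : V) : ∃ t : Γ(M, D m),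
      χ.app (D m) t = Y.presheaf.map (homOfLE (χ.preimage_mono (hDV m))).op s :=
    (hD m).exists_eq _ fun g hg ↦ by rw [map_pull _ (hDV m), hs g hg]
  choose t ht using hloc
  obtain ⟨T, hT, -⟩ := M.sheaf.existsUnique_gluing' D V (fun m ↦ homOfLE (hDV m)) hcov t (by
    intro m m'
    refine hinj _ ?_
    refine (map_app_apply χ (U := D m) (V := D m ⊓ D m') inf_le_left (t m)).trans
      (Eq.trans ?_ (map_app_apply χ (U := D m') (V := D m ⊓ D m') inf_le_right (t m')).symm)
    rw [ht, ht, ← CommRingCat.comp_apply, ← CommRingCat.comp_apply, ← Functor.map_comp,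
      ← Functor.map_comp]
    rfl)
  refine ⟨T, Y.sheaf.eq_of_locally_eq' (fun m ↦ χ ⁻¹ᵁ D m) (χ ⁻¹ᵁ V)
    (fun m ↦ homOfLE (χ.preimage_mono (hDV m))) (fun y hy ↦ ?_) _ _ fun m ↦ ?_⟩
  · exact TopologicalSpace.Opens.mem_iSup.mpr ⟨⟨χ y, hy⟩, hmD ⟨χ y, hy⟩⟩
  · refine (map_app_apply χ (hDV m) T).symm.trans ?_
    exact (congr_arg _ (hT m)).trans (ht m)

/-- On an affine chart this is the transitivity of a finite group on the primes over a given prime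
of the ring of invariants. -/
theorem exists_of_eq_of_isInvariantsOn [Finite H] {U : M.Opens} (h : IsInvariantsOn inv U)
    (hU : IsAffineOpen U) (hU' : IsAffineOpen (χ ⁻¹ᵁ U)) (y y' : Y) (hy : χ y ∈ U)
    (hyy' : χ y = χ y') : ∃ g ∈ H, Gal.toHom g y = y' := by
  let B := Γ(Y, χ ⁻¹ᵁ U)
  let : Algebra Γ(M, U) B := (χ.app U).hom.toAlgebra
  let : MulSemiringAction H B := sectionsAction H.subtype (fun p ↦ inv p p.2) U
  have : SMulCommClass H Γ(M, U) B := ⟨fun g a b ↦ by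
    change pull _ U (χ.app U a * b) = χ.app U a * pull _ U b
    rw [map_mul, pull_app_apply]⟩
  have : Algebra.IsInvariant Γ(M, U) B H := ⟨fun b hb ↦ h.exists_eq b fun g hg ↦ by
    have := hb (⟨g, hg⟩⁻¹ : H)
    change pull _ U b = b at this
    convert this
    simp⟩
  obtain ⟨p, rfl⟩ : y ∈ Set.range hU'.fromSpec := by rw [hU'.range_fromSpec]; exact hy
  obtain ⟨p', rfl⟩ : y' ∈ Set.range hU'.fromSpec := by
    rw [hU'.range_fromSpec]; change χ y' ∈ U; rwa [← hyy']
  have key (p : Spec Γ(Y, χ ⁻¹ᵁ U)) :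
      χ (hU'.fromSpec p) = hU.fromSpec (Spec.map (χ.app U) p) := by
    rw [← Scheme.Hom.comp_apply, ← Scheme.Hom.comp_apply, Scheme.Hom.app_eq_appLE,
      IsAffineOpen.SpecMap_appLE_fromSpec _ hU hU']
  have hunder : p.asIdeal.under Γ(M, U) = p'.asIdeal.under Γ(M, U) := by
    rw [key, key] at hyy'
    exact congr_arg PrimeSpectrum.asIdeal (hU.fromSpec.injective hyy')
  have : p.asIdeal.IsPrime := p.2
  have : p'.asIdeal.IsPrime := p'.2
  obtain ⟨g, hg⟩ := Algebra.IsInvariant.exists_smul_of_under_eq Γ(M, U) B H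
    p.asIdeal p'.asIdeal hunder
  refine ⟨g, g.2, ?_⟩
  have h2 : Gal.toHom (g : Gal f) (hU'.fromSpec p) =
      hU'.fromSpec (Spec.map (pull (inv g g.2) U) p) := by
    rw [← Scheme.Hom.comp_apply, ← Scheme.Hom.comp_apply, pull,
      IsAffineOpen.SpecMap_appLE_fromSpec _ hU' hU']
  rw [h2]
  congr 1
  refine PrimeSpectrum.ext ?_
  rw [hg]
  ext b
  refine Iff.trans ?_ Ideal.mem_pointwise_smul_iff_inv_smul_mem.symm
  change pull _ U b ∈ p.asIdeal ↔ pull _ U b ∈ p.asIdeal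
  simp

/-- A criterion for `χ` to be a quotient by a finite group, to be checked on an affine open cover
of the target. -/
theorem isQuotientBy_of_affineCover [Finite H] [IsIntegralHom χ] [Surjective χ]
    (inv : ∀ g ∈ H, Gal.toHom g ≫ χ = χ)
    (h : ∀ m : M, ∃ U : M.Opens, m ∈ U ∧ IsAffineOpen U ∧ IsInvariantsOn inv U) :
    IsQuotientBy H χ := by
  have hall := isInvariantsOn_of_basis (inv := inv) (fun V m hm ↦ by
    obtain ⟨U, hmU, hU, hinvU⟩ := h m
    obtain ⟨r, hr, hmr⟩ := hU.exists_basicOpen_le ⟨m, hm⟩ hmU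
    exact ⟨M.basicOpen r, hr, hmr, hinvU.basicOpen hU (hU.preimage χ) r⟩)
  refine ⟨inv, χ.isClosedMap.isQuotientMap χ.continuous χ.surjective, fun y y' e ↦ ?_,
    fun U ↦ (hall U).injective, fun U s hs ↦ (hall U).exists_eq s hs⟩
  obtain ⟨U, hmU, hU, hinvU⟩ := h (χ y)
  exact exists_of_eq_of_isInvariantsOn hinvU hU (hU.preimage χ) y y' hmU e

theorem IsQuotientBy.isInvariantsOn (h : IsQuotientBy H χ) (U : M.Opens) :
    IsInvariantsOn h.invariant U :=
  ⟨h.app_injective U, h.exists_app_eq U⟩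

end Criterion

/-! ### The universal property of the quotient. -/

section Descent

variable {Y M Z : Scheme.{u}} {χ : Y ⟶ M}

theorem eq_of_comp_eq (hs : Function.Surjective χ) (hinj : ∀ U : M.Opens, Function.Injective (χ.app U))
    {b b' : M ⟶ Z} (h : χ ≫ b = χ ≫ b') : b = b' := by
  have hbase : b.base = b'.base := by
    ext m
    obtain ⟨y, rfl⟩ := hs m
    exact congr($h y)
  refine Scheme.Hom.ext hbase fun U ↦ ?_
  ext s
  refine hinj _ ?_
  have hU : b' ⁻¹ᵁ U = b ⁻¹ᵁ U := by
    ext m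
    change b' m ∈ U ↔ b m ∈ U
    rw [show b' m = b m from congr($hbase.symm m)]
  change χ.app (b' ⁻¹ᵁ U) (M.presheaf.map (homOfLE hU.le).op (b.app U s)) = _
  rw [map_app_apply χ hU.le]
  simp only [← CommRingCat.comp_apply, Scheme.Hom.app_eq_appLE, Scheme.Hom.appLE_map,
    Scheme.Hom.appLE_comp_appLE, h]

/-- Lifts of functions through the injective maps `χ.app` are unique, so they automatically form
ring homomorphisms compatible with restriction. Using `copyBase` makes the preimages under `a`
literally those under `b ∘ χ`. -/
theorem exists_desc (hs : Function.Surjective χ)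
    (hinj : ∀ U : M.Opens, Function.Injective (χ.app U)) (a : Y ⟶ Z) (b : C(M, Z))
    (hb : a.base = b ∘ χ)
    (hlift : ∀ (U : Z.Opens) (s : Γ(Z, U)), ∃ t : Γ(M, (TopologicalSpace.Opens.map
      (TopCat.ofHom b)).obj U), χ.app _ t = (a.copyBase _ hb).app U s) :
    ∃ u : M ⟶ Z, χ ≫ u = a := by
  choose T hT using hlift
  let d (U : Z.Opens) := ((a.copyBase _ hb).app U).hom
  let c (U : Z.Opens) : Γ(Z, U) →+* Γ(M, (TopologicalSpace.Opens.map (TopCat.ofHom b)).obj U) :=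
    { toFun := T U
      map_one' := hinj _ (((hT _ _).trans (map_one (d U))).trans
        (map_one (χ.app ((TopologicalSpace.Opens.map (TopCat.ofHom b)).obj U)).hom).symm)
      map_mul' := fun x y ↦ hinj _ ((hT _ _).trans ((map_mul (d U) x y).trans
        (((map_mul (χ.app _).hom _ _).trans (congr_arg₂ _ (hT U x) (hT U y))).symm)))
      map_zero' := hinj _ (((hT _ _).trans (map_zero (d U))).trans
        (map_zero (χ.app ((TopologicalSpace.Opens.map (TopCat.ofHom b)).obj U)).hom).symm)
      map_add' := fun x y ↦ hinj _ ((hT _ _).trans ((map_add (d U) x y).trans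
        (((map_add (χ.app _).hom _ _).trans (congr_arg₂ _ (hT U x) (hT U y))).symm))) }
  let w : M.toPresheafedSpace ⟶ Z.toPresheafedSpace :=
    { base := TopCat.ofHom b
      c :=
        { app := fun U ↦ CommRingCat.ofHom (c U.unop)
          naturality := fun U V i ↦ by
            ext s
            refine hinj _ ?_
            have h1 := (hT V.unop (Z.presheaf.map i s))
            refine h1.trans ?_
            have h2 := map_app_apply χ
              ((TopologicalSpace.Opens.map (TopCat.ofHom b)).map i.unop).le (T U.unop s)
            refine Eq.trans ?_ h2.symm
            rw [hT]
            exact congr($((a.copyBase _ hb).naturality i) s) } }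
  have hw : χ.toPshHom ≫ w = (a.copyBase _ hb).toPshHom := by
    refine PresheafedSpace.Hom.ext _ _ rfl ?_
    refine TopCat.Presheaf.ext fun U ↦ ?_
    ext s
    have h1 : Y.presheaf.map (𝟙 _) (χ.app _ (T U s)) = (a.copyBase _ hb).app U s := by
      rw [Y.presheaf.map_id, hT]
      rfl
    exact h1
  -- Every `m` is some `χ y`, and the stalk map of `a` at `y` is local and factors through that of
  -- `w` at `m`.
  have hloc (m : M) : IsLocalHom (w.stalkMap m).hom := by
    obtain ⟨y, rfl⟩ := hs m
    have h1 : IsLocalHom ((χ.toPshHom ≫ w).stalkMap y).hom := by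
      rw [hw]
      exact (a.copyBase _ hb).prop y
    have e := PresheafedSpace.stalkMap.comp χ.toPshHom w y
    exact ⟨fun t ht ↦ h1.map_nonunit t
      ((congr_arg IsUnit congr($e t)).mpr (ht.map (χ.toPshHom.stalkMap y).hom))⟩
  refine ⟨⟨⟨w, hloc⟩⟩, ?_⟩
  refine Eq.trans ?_ (Scheme.Hom.copyBase_eq a _ hb)
  exact Scheme.Hom.ext' (LocallyRingedSpace.Hom.ext' hw)

section Quotient

variable {X : Scheme.{u}} {f : Y ⟶ X} {H : Subgroup (Gal f)}

theorem IsQuotientBy.hom_ext (h : IsQuotientBy H χ) {b b' : M ⟶ Z} (e : χ ≫ b = χ ≫ b') : b = b' :=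
  eq_of_comp_eq h.isQuotientMap.surjective h.app_injective e

/-- The quotient by a group of automorphisms is a categorical quotient. -/
theorem IsQuotientBy.exists_desc (h : IsQuotientBy H χ) (a : Y ⟶ Z)
    (ha : ∀ g ∈ H, Gal.toHom g ≫ a = a) : ∃ u : M ⟶ Z, χ ≫ u = a := by
  have hfac (y y' : Y) (e : χ y = χ y') : a y = a y' := by
    obtain ⟨g, hg, rfl⟩ := h.exists_of_eq y y' e
    rw [← Scheme.Hom.comp_apply, ha g hg]
  let b : C(M, Z) := h.isQuotientMap.lift ⟨a, a.continuous⟩ hfac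
  have hb (y : Y) : b (χ y) = a y := by
    exact congr($(h.isQuotientMap.lift_comp ⟨a, a.continuous⟩ hfac) y)
  have hb' : a.base = b ∘ χ := funext fun y ↦ (hb y).symm
  refine QuotVar.exists_desc h.isQuotientMap.surjective h.app_injective a b hb' fun U s ↦ ?_
  refine h.exists_app_eq _ _ fun g hg ↦ ?_
  generalize_proofs h1 h2
  have e : a.copyBase _ hb' = a := Scheme.Hom.copyBase_eq a _ hb'
  have hg' : Gal.toHom g ≫ a.copyBase _ hb' = a.copyBase _ hb' := by rw [e, ha g hg]
  exact pull_app_apply hg' U s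

end Quotient

end Descent

/-! ### Construction of the quotient as a relative spectrum over the base. -/

section Construction

open Scheme AffineZariskiSite

variable {X Y : Scheme.{u}} {f : Y ⟶ X} (H : Subgroup (Gal f))

/-- The ring of `H`-invariant functions on `f ⁻¹ U`. -/
def invariantSections (U : X.Opens) : Subring Γ(Y, f ⁻¹ᵁ U) where
  carrier := {s | ∀ g ∈ H, pull (Gal.toHom_comp g) U s = s}
  mul_mem' ha hb g hg := by rw [map_mul, ha g hg, hb g hg]
  one_mem' g hg := map_one _
  add_mem' ha hb g hg := by rw [map_add, ha g hg, hb g hg]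
  zero_mem' g hg := map_zero _
  neg_mem' ha g hg := by rw [map_neg, ha g hg]

/-- The presheaf on `X` of `H`-invariant functions on `Y`. -/
def invariantPresheaf : X.Opensᵒᵖ ⥤ CommRingCat.{u} where
  obj U := .of (invariantSections H U.unop)
  map {U V} i := CommRingCat.ofHom
    ((Y.presheaf.map (homOfLE (f.preimage_mono i.unop.le)).op).hom.restrict _ _
      fun s hs g hg ↦ (map_pull (Gal.toHom_comp g) i.unop.le s).trans (by rw [hs g hg]))
  map_id U := by
    ext s
    exact congr($(Y.presheaf.map_id _) s.1)
  map_comp {U V W} i j := by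
    ext s
    exact congr($(Y.presheaf.map_comp (homOfLE (f.preimage_mono i.unop.le)).op
      (homOfLE (f.preimage_mono j.unop.le)).op) s.1)

/-- The inclusion of the structure sheaf of `X` in the invariant functions on `Y`. -/
def toInvariantPresheaf : X.presheaf ⟶ invariantPresheaf H where
  app U := CommRingCat.ofHom ((f.app U.unop).hom.codRestrict (invariantSections H U.unop)
    fun s g _ ↦ pull_app_apply _ _ s)
  naturality {U V} i := by
    ext s
    exact Subtype.ext (map_app_apply f i.unop.le s)

/-- This is quasi-coherence of the sheaf of invariants, the condition under which the spectra of its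
sections over affine opens glue. -/
theorem coequifibered_toInvariantPresheaf [IsAffineHom f] [Finite H] :
    ((toOpensFunctor X).op.whiskerLeft (toInvariantPresheaf H)).Coequifibered := by
  refine coequifibered_iff_forall_isLocalizationAway.mpr fun U r ↦ ?_
  let : Algebra (invariantSections H U.1) (invariantSections H (X.basicOpen r)) :=
    ((invariantPresheaf H).map (homOfLE (X.basicOpen_le r)).op).hom.toAlgebra
  have hle := X.basicOpen_le r
  have hA := isAwayMap_basicOpen U.2 r rfl hle
  have hB := isAwayMap_app_basicOpen f (U.2.preimage f) r (f.preimage_mono hle)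
  let α (U : X.Opens) := ((toInvariantPresheaf H).app (.op U)).hom
  refine IsAwayMap.isLocalization (A := invariantSections H U.1)
    (A' := invariantSections H (X.basicOpen r)) (r := α U.1 r) ⟨?_, fun t ↦ ?_, fun b hb ↦ ?_⟩
  · have : algebraMap (invariantSections H U.1) (invariantSections H (X.basicOpen r)) (α U.1 r) =
        α (X.basicOpen r) (X.presheaf.map (homOfLE hle).op r) :=
      Subtype.ext (map_app_apply f hle r).symm
    rw [this]
    exact hA.isUnit.map (α (X.basicOpen r))
  · obtain ⟨n, b, hb, hsb⟩ := hB.exists_fixed (ι := H)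
      (γ := fun g ↦ (pull (Gal.toHom_comp (g : Gal f)) U.1).hom)
      (γ' := fun g ↦ (pull (Gal.toHom_comp (g : Gal f)) (X.basicOpen r)).hom)
      (fun g b ↦ (map_pull (Gal.toHom_comp (g : Gal f)) hle b).symm)
      (fun g ↦ pull_app_apply (Gal.toHom_comp (g : Gal f)) U.1 r) t.1 (fun g ↦ t.2 g g.2)
    exact ⟨n, ⟨b, fun g hg ↦ hb ⟨g, hg⟩⟩, Subtype.ext hsb⟩
  · obtain ⟨n, hn⟩ := hB.ker b.1 congr(($hb).1)
    exact ⟨n, Subtype.ext hn⟩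

variable [IsAffineHom f] [Finite H]

/-- The gluing datum for the quotient of `Y` by `H`. -/
noncomputable def quotientGlueData := relativeGluingData (coequifibered_toInvariantPresheaf H)

/-- The quotient of `Y` by the finite group `H` of automorphisms over `X`. -/
noncomputable def quotientScheme : Scheme.{u} := (quotientGlueData H).glued

/-- The structure morphism from the quotient to the base. -/
noncomputable def quotientToBase : quotientScheme H ⟶ X := (quotientGlueData H).toBase

/-- The affine open cover of the quotient by the spectra of rings of invariants. -/
noncomputable def quotientCover : (quotientScheme H).OpenCover := (quotientGlueData H).cover

instance : ((quotientGlueData H).functor ⋙ Scheme.forget).IsLocallyDirected :=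
  Cover.RelativeGluingData.instIsLocallyDirectedI₀CompFunctorForgetOfIsThin ..

/-- The chart of the quotient over an affine open of the base. -/
noncomputable def quotientChart (U : X.affineOpens) :
    Spec (.of (invariantSections H U.1)) ⟶ quotientScheme H :=
  (quotientCover H).f U

instance (U : X.affineOpens) : IsOpenImmersion (quotientChart H U) :=
  (quotientCover H).map_prop U

/-- The map from `f ⁻¹ U` to the spectrum of the invariant functions. -/
noncomputable def toSpecInvariants (U : X.affineOpens) :
    (f ⁻¹ᵁ U.1).toScheme ⟶ Spec (.of (invariantSections H U.1)) :=
  (f ⁻¹ᵁ U.1).toSpecΓ ≫ Spec.map (CommRingCat.ofHom (invariantSections H U.1).subtype)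

theorem homOfLE_toSpecInvariants {U V : X.affineOpens} (hle : U.1 ≤ V.1)
    (h : Spec.map ((invariantPresheaf H).map (homOfLE hle).op) ≫ quotientChart H V =
      quotientChart H U) :
    Y.homOfLE (f.preimage_mono hle) ≫ toSpecInvariants H V ≫ quotientChart H V =
      toSpecInvariants H U ≫ quotientChart H U := by
  let r : CommRingCat.of (invariantSections H V.1) ⟶ .of (invariantSections H U.1) :=
    (invariantPresheaf H).map (homOfLE hle).op
  have h' : CommRingCat.ofHom (invariantSections H V.1).subtype ≫
      Y.presheaf.map (homOfLE (f.preimage_mono hle)).op =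
      r ≫ CommRingCat.ofHom (invariantSections H U.1).subtype := rfl
  trans toSpecInvariants H U ≫ Spec.map r ≫ quotientChart H V
  · delta toSpecInvariants
    rw [Category.assoc, Category.assoc, ← Scheme.Opens.toSpecΓ_SpecMap_presheaf_map_assoc,
      ← Spec.map_comp_assoc, h', Spec.map_comp_assoc]
  · exact congr(_ ≫ $h)

theorem toSpecInvariants_compatible {U V : X.AffineZariskiSite} (i : U ⟶ V) :
    Cover.trans ((directedCover X).pullback₁ f) i ≫ (pullbackRestrictIsoRestrict f V.1).hom ≫
      toSpecInvariants H V ≫ quotientChart H V =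
    (pullbackRestrictIsoRestrict f U.1).hom ≫ toSpecInvariants H U ≫ quotientChart H U := by
  have hle : U.1 ≤ V.1 := toOpens_mono i.1.1
  have h : Limits.pullback.map f U.1.ι f V.1.ι (𝟙 Y) (X.homOfLE hle) (𝟙 X)
        (by simp) (by simp) ≫ (pullbackRestrictIsoRestrict f V.1).hom =
      (pullbackRestrictIsoRestrict f U.1).hom ≫ Y.homOfLE (f.preimage_mono hle) := by
    rw [← cancel_mono (Scheme.Opens.ι _), Category.assoc, Category.assoc,
      pullbackRestrictIsoRestrict_hom_ι, Scheme.homOfLE_ι Y, pullbackRestrictIsoRestrict_hom_ι]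
    exact (Limits.pullback.lift_fst _ _ _).trans (Category.comp_id _)
  refine (Category.assoc _ _ _).symm.trans ?_
  refine congr($h ≫ toSpecInvariants H V ≫ quotientChart H V).trans ?_
  rw [Category.assoc]
  exact congr(_ ≫ $(homOfLE_toSpecInvariants H hle
    (Limits.colimit.w (quotientGlueData H).functor i)))

/-- The quotient morphism. -/
noncomputable def toQuotient : Y ⟶ quotientScheme H :=
  Scheme.OpenCover.glueMorphismsOfLocallyDirected
    ((directedCover X).pullback₁ f)
    (fun U ↦ (pullbackRestrictIsoRestrict f _).hom ≫ toSpecInvariants H U ≫ quotientChart H U)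
    (toSpecInvariants_compatible H)

theorem ι_toQuotient (U : X.affineOpens) :
    (f ⁻¹ᵁ U.1).ι ≫ toQuotient H = toSpecInvariants H U ≫ quotientChart H U := by
  rw [← cancel_epi (pullbackRestrictIsoRestrict f U.1).hom, ← Category.assoc,
    pullbackRestrictIsoRestrict_hom_ι]
  exact Scheme.OpenCover.map_glueMorphismsOfLocallyDirected _ _ (toSpecInvariants_compatible H) _

/-- The inclusion of the functions on `U` in the invariant functions on `f ⁻¹ U`. -/
def toInvariants (U : X.Opens) : Γ(X, U) ⟶ .of (invariantSections H U) :=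
  (toInvariantPresheaf H).app (.op U)

theorem quotientChart_toBase {U : X.Opens} (hU : IsAffineOpen U) :
    quotientChart H ⟨U, hU⟩ ≫ quotientToBase H = Spec.map (toInvariants H U) ≫ hU.fromSpec :=
  Limits.colimit.ι_desc _ _

theorem quotientToBase_preimage (U : X.affineOpens) :
    quotientToBase H ⁻¹ᵁ U = (quotientChart H U).opensRange := by
  simpa using! (quotientGlueData H).toBase_preimage_eq_opensRange_ι U

theorem toQuotient_toBase : toQuotient H ≫ quotientToBase H = f := by
  refine Scheme.Cover.hom_ext (Y.openCoverOfIsOpenCover _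
    (.comap (iSup_affineOpens_eq_top X) f.base.1)) _ _ fun (U : X.affineOpens) ↦ ?_
  suffices h : ∀ {U : X.Opens} (hU : IsAffineOpen U),
      (f ⁻¹ᵁ U).ι ≫ toQuotient H ≫ quotientToBase H = (f ⁻¹ᵁ U).ι ≫ f from h U.2
  intro U hU
  have h : toInvariants H U ≫ CommRingCat.ofHom (invariantSections H U).subtype = f.app U := rfl
  refine ((Category.assoc _ _ _).symm.trans congr($(ι_toQuotient H ⟨U, hU⟩) ≫ _)).trans ?_
  rw [Category.assoc, quotientChart_toBase]
  delta toSpecInvariants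
  rw [Category.assoc, ← Spec.map_comp_assoc, h]
  simp

end Construction

/-! ### The construction is a quotient. -/

section QuotientProperties

open Scheme AffineZariskiSite

variable {X Y : Scheme.{u}} {f : Y ⟶ X} (H : Subgroup (Gal f))

theorem fromSpec_toHom (g : Gal f) {U : X.Opens} (hU : IsAffineOpen (f ⁻¹ᵁ U)) :
    hU.fromSpec ≫ Gal.toHom g = Spec.map (pull (Gal.toHom_comp g) U) ≫ hU.fromSpec :=
  (IsAffineOpen.SpecMap_appLE_fromSpec _ hU hU _).symm

theorem hom_ext_of_affineOpens (f : Y ⟶ X) {Z : Scheme.{u}} {a b : Y ⟶ Z}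
    (h : ∀ U : X.affineOpens, (f ⁻¹ᵁ U.1).ι ≫ a = (f ⁻¹ᵁ U.1).ι ≫ b) : a = b :=
  Scheme.Cover.hom_ext (Y.openCoverOfIsOpenCover _
    (.comap (iSup_affineOpens_eq_top X) f.base.1)) _ _ h

theorem isIntegral_subtype_invariantSections [IsIntegralHom f] (U : X.affineOpens) :
    (invariantSections H U.1).subtype.IsIntegral :=
  RingHom.IsIntegral.tower_top ((toInvariantPresheaf H).app (.op U.1)).hom _
    (f.isIntegral_app U.1 U.2)

section

variable [IsIntegralHom f] [Finite H]

theorem fromSpec_toQuotient (U : X.affineOpens) :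
    (U.2.preimage f).fromSpec ≫ toQuotient H =
      Spec.map (CommRingCat.ofHom (invariantSections H U.1).subtype) ≫ quotientChart H U := by
  rw [← IsAffineOpen.isoSpec_inv_ι, Category.assoc, ι_toQuotient, toSpecInvariants,
    Category.assoc, ← (U.2.preimage f).isoSpec_hom, Iso.inv_hom_id_assoc]

instance : IsAffineHom (quotientToBase H) where
  isAffine_preimage U hU := by
    rw [quotientToBase_preimage H ⟨U, hU⟩]
    exact isAffineOpen_opensRange _

theorem toHom_toQuotient (g : Gal f) (hg : g ∈ H) :
    Gal.toHom g ≫ toQuotient H = toQuotient H := by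
  refine hom_ext_of_affineOpens f fun U ↦ ?_
  rw [← (U.2.preimage f).toSpecΓ_fromSpec, Category.assoc, Category.assoc,
    reassoc_of% fromSpec_toHom g (U.2.preimage f), fromSpec_toQuotient, ← Spec.map_comp_assoc]
  congr 3
  ext s
  exact s.2 g hg

instance : IsIntegralHom (toQuotient H) := by
  have : IsIntegralHom (toQuotient H ≫ quotientToBase H) := by rwa [toQuotient_toBase]
  exact IsIntegralHom.of_comp _ (quotientToBase H)

theorem toQuotient_preimage (U : X.affineOpens) :
    toQuotient H ⁻¹ᵁ (quotientChart H U).opensRange = f ⁻¹ᵁ U.1 := by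
  rw [← quotientToBase_preimage, ← Scheme.Hom.comp_preimage, toQuotient_toBase]

theorem exists_mem_quotientChart (m : quotientScheme H) :
    ∃ U : X.affineOpens, m ∈ (quotientChart H U).opensRange := by
  obtain ⟨U, hU, hm, -⟩ := X.isBasis_affineOpens.exists_subset_of_mem_open
    (Set.mem_univ (quotientToBase H m)) isOpen_univ
  obtain ⟨U, hU, rfl⟩ := hU
  refine ⟨⟨U, hU⟩, ?_⟩
  rw [← quotientToBase_preimage]
  exact hm

instance : Surjective (toQuotient H) := by
  refine ⟨fun m ↦ ?_⟩
  obtain ⟨U, c, rfl⟩ := exists_mem_quotientChart H m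
  obtain ⟨p, hp⟩ := (isIntegral_subtype_invariantSections H U).comap_surjective
    Subtype.val_injective c
  refine ⟨(U.2.preimage f).fromSpec p, ?_⟩
  exact congr($(fromSpec_toQuotient H U) p).trans (congr_arg (quotientChart H U) hp)

/-- In chart coordinates, pullback of functions along the quotient map is the inclusion of the
invariants; `isInvariantsOn_toQuotient` is read off from this. -/
theorem appLE_toQuotient (U : X.affineOpens) :
    (toQuotient H).appLE (quotientChart H U).opensRange (f ⁻¹ᵁ U.1)
        (toQuotient_preimage H U).ge =
      (quotientChart H U).appLE (quotientChart H U).opensRange ⊤ (by simp) ≫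
      (Scheme.ΓSpecIso _).hom ≫ CommRingCat.ofHom (invariantSections H U.1).subtype := by
  have hV := U.2.preimage f
  have h1 : hV.fromSpec.appLE (f ⁻¹ᵁ U.1) ⊤ (by simp) = (Scheme.ΓSpecIso _).inv := by
    rw [Scheme.Hom.appLE, hV.fromSpec_app_self, Category.assoc, ← Functor.map_comp]
    convert Category.comp_id _
    exact (Spec Γ(Y, f ⁻¹ᵁ U.1)).presheaf.map_id _
  have h2 := Scheme.Hom.appLE_comp_appLE hV.fromSpec (toQuotient H)
    (quotientChart H U).opensRange (f ⁻¹ᵁ U.1) ⊤ (toQuotient_preimage H U).ge (by simp)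
  rw [h1] at h2
  rw [← cancel_mono (Scheme.ΓSpecIso _).inv, h2]
  have h3 := Scheme.Hom.appLE_comp_appLE (Spec.map (CommRingCat.ofHom
    (invariantSections H U.1).subtype)) (quotientChart H U)
    (quotientChart H U).opensRange ⊤ ⊤ (by simp) le_top
  simp only [fromSpec_toQuotient]
  rw [← h3, Category.assoc, Category.assoc]
  congr 1
  exact (Scheme.Hom.appLE_eq_app (Spec.map _)).trans
    ((Iso.inv_comp_eq _).mp (Scheme.ΓSpecIso_inv_naturality _).symm)

theorem isInvariantsOn_toQuotient (U : X.affineOpens) :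
    IsInvariantsOn (toHom_toQuotient H) (quotientChart H U).opensRange := by
  have hW := toQuotient_preimage H U
  let e : Γ(Y, toQuotient H ⁻¹ᵁ (quotientChart H U).opensRange) ⟶ Γ(Y, f ⁻¹ᵁ U.1) :=
    Y.presheaf.map (homOfLE hW.ge).op
  have he : Function.Injective e := by
    have : IsIso (homOfLE hW.ge) := ⟨homOfLE hW.le, rfl, rfl⟩
    exact ((ConcreteCategory.isIso_iff_bijective e).mp inferInstance).1
  have hiso : IsIso ((quotientChart H U).appLE (quotientChart H U).opensRange ⊤ (by simp)) := by
    have := Scheme.Hom.isIso_app (quotientChart H U) (quotientChart H U).opensRange le_rfl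
    have h : (quotientChart H U) ⁻¹ᵁ (quotientChart H U).opensRange = ⊤ := by simp
    have : IsIso (homOfLE h.ge) := ⟨homOfLE h.le, rfl, rfl⟩
    rw [Scheme.Hom.appLE]
    infer_instance
  have hbij := (ConcreteCategory.isIso_iff_bijective
    ((quotientChart H U).appLE (quotientChart H U).opensRange ⊤ (by simp) ≫
      (Scheme.ΓSpecIso _).hom)).mp inferInstance
  have key (t : Γ(quotientScheme H, (quotientChart H U).opensRange)) :
      e ((toQuotient H).app _ t) = (((quotientChart H U).appLE (quotientChart H U).opensRange ⊤
        (by simp) ≫ (Scheme.ΓSpecIso _).hom) t : invariantSections H U.1).1 :=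
    congr($(appLE_toQuotient H U) t)
  refine ⟨fun s t hst ↦ hbij.1 (Subtype.ext ?_), fun s hs ↦ ?_⟩
  · rw [← key, ← key, hst]
  · have hmem : e s ∈ invariantSections H U.1 := by
      intro g hg
      conv_rhs => rw [← hs g hg]
      simp only [e, pull, ← CommRingCat.comp_apply, Scheme.Hom.appLE_map, Scheme.Hom.map_appLE]
    obtain ⟨t, ht⟩ := hbij.2 ⟨e s, hmem⟩
    exact ⟨t, he ((key t).trans congr(($ht).1))⟩

theorem isQuotientBy_toQuotient : IsQuotientBy H (toQuotient H) :=
  isQuotientBy_of_affineCover (toHom_toQuotient H) fun m ↦ by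
    obtain ⟨U, hU⟩ := exists_mem_quotientChart H m
    exact ⟨_, hU, isAffineOpen_opensRange _, isInvariantsOn_toQuotient H U⟩

end

end QuotientProperties

/-! ### Étaleness of the quotient over the base. -/

section EtaleQuotient

variable {X Y : Scheme.{u}} {f : Y ⟶ X} (I : Subgroup (Gal f))

/-- In a Jacobson space a closed point of an open subset is closed in the whole space, so a
stabilized maximal ideal on a chart is a genuine fixed closed point. -/
theorem hasFixedPoint_of_isMaximal [JacobsonSpace Y] {U : X.Opens}
    (hU : IsAffineOpen (f ⁻¹ᵁ U)) (g : Gal f) (n : Ideal Γ(Y, f ⁻¹ᵁ U)) (hn : n.IsMaximal)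
    (h : ∀ b, pull (Gal.toHom_comp g) U b ∈ n ↔ b ∈ n) : HasFixedPoint g := by
  let p : Spec Γ(Y, f ⁻¹ᵁ U) := ⟨n, hn.isPrime⟩
  have hp : IsClosed {p} := (PrimeSpectrum.isClosed_singleton_iff_isMaximal _).mpr hn
  refine ⟨hU.fromSpec p, isClosed_singleton_of_isLocallyClosed_singleton ?_, ?_⟩
  · rw [← Set.image_singleton]
    exact hp.isLocallyClosed.image hU.fromSpec.isOpenEmbedding.isInducing
      hU.fromSpec.isOpenEmbedding.isOpen_range.isLocallyClosed
  · refine congr($(fromSpec_toHom g hU) p).trans (congr_arg hU.fromSpec ?_)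
    exact PrimeSpectrum.ext (Ideal.ext h)

theorem etale_toInvariants [Finite (Gal f)] [JacobsonSpace Y] [I.Normal]
    (hf : IsQuotientBy (f := f) ⊤ f) (hI : ∀ g : Gal f, HasFixedPoint g → g ∈ I) {U : X.Opens}
    (hU : IsAffineOpen (f ⁻¹ᵁ U)) : (toInvariants I U).hom.Etale := by
  let A := Γ(X, U)
  let B := Γ(Y, f ⁻¹ᵁ U)
  let : Algebra A B := (f.app U).hom.toAlgebra
  let : MulSemiringAction (Gal f) B :=
    sectionsAction (MonoidHom.id (Gal f)) (χ := f) Gal.toHom_comp U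
  have hsmul (g : Gal f) (b : B) : g • b = pull (Gal.toHom_comp g⁻¹) U b := rfl
  have : SMulCommClass (Gal f) A B := ⟨fun g a b ↦ by
    change pull _ U (f.app U a * b) = f.app U a * pull _ U b
    rw [map_mul, pull_app_apply]⟩
  have : Algebra.IsInvariant A B (Gal f) := ⟨fun b hb ↦ (hf.isInvariantsOn U).exists_eq b fun g _ ↦ by
    have := hb g⁻¹
    change pull _ U b = b at this
    convert this
    simp⟩
  have key : Algebra.Etale A (FixedPoints.subalgebra A B I) :=
    etale_fixedPoints I (hf.app_injective U) fun g n hn h ↦ by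
      -- The action of `g` on functions is pullback along `g⁻¹`, so it is `g⁻¹` that fixes the
      -- point.
      rw [← inv_mem_iff]
      exact hI _ (hasFixedPoint_of_isMaximal hU g⁻¹ n hn h)
  have hmem (b : B) : b ∈ FixedPoints.subalgebra A B I ↔ b ∈ invariantSections I U := by
    refine ⟨fun h g hg ↦ ?_, fun h g ↦ h _ (I.inv_mem g.2)⟩
    have := h (⟨g⁻¹, I.inv_mem hg⟩ : I)
    change pull _ U b = b at this
    convert this
    simp
  let : Algebra A (invariantSections I U) :=
    ((toInvariantPresheaf I).app (.op U)).hom.toAlgebra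
  let e : FixedPoints.subalgebra A B I ≃ₐ[A] invariantSections I U :=
    { toFun := fun b ↦ ⟨b.1, (hmem b.1).mp b.2⟩
      invFun := fun b ↦ ⟨b.1, (hmem b.1).mpr b.2⟩
      left_inv := fun _ ↦ rfl
      right_inv := fun _ ↦ rfl
      map_mul' := fun _ _ ↦ rfl
      map_add' := fun _ _ ↦ rfl
      commutes' := fun _ ↦ rfl }
  exact (Algebra.Etale.of_equiv e : Algebra.Etale A (invariantSections I U))

/-- If the normal subgroup `I` contains all automorphisms with a fixed point, the quotient of `Y`
by `I` is étale over the base. -/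
theorem etale_quotientToBase [IsIntegralHom f] [Finite (Gal f)] [JacobsonSpace Y] [I.Normal]
    (hf : IsQuotientBy (f := f) ⊤ f) (hI : ∀ g : Gal f, HasFixedPoint g → g ∈ I) :
    Etale (quotientToBase I) := by
  have : IsZariskiLocalAtSource @Etale := HasRingHomProperty.instIsZariskiLocalAtSource
  refine IsZariskiLocalAtSource.of_openCover (P := @Etale) (quotientCover I) fun U ↦ ?_
  suffices h : ∀ {U : X.Opens} (hU : IsAffineOpen U),
      Etale (quotientChart I ⟨U, hU⟩ ≫ quotientToBase I) from h U.2
  intro U hU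
  have : Etale (Spec.map (toInvariants I U)) :=
    HasRingHomProperty.Spec_iff.mpr (etale_toInvariants I hf hI (hU.preimage f))
  rw [quotientChart_toBase]
  exact Etale.etale_comp _ _

end EtaleQuotient

/-! ### The subgroup generated by automorphisms with fixed points. -/

section Generators

variable {X Y : Scheme.{u}} {f : Y ⟶ X}

/-- If `g` fixes `y`, the conjugate fixes `σ y`. This yields normality of `fixSubgroup f`. -/
theorem HasFixedPoint.conj {g : Gal f} (hg : HasFixedPoint g) (σ : Gal f) :
    HasFixedPoint (σ * g * σ⁻¹) := by
  obtain ⟨y, hy, hgy⟩ := hg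
  refine ⟨Gal.toHom σ y, ?_, ?_⟩
  · rw [← Set.image_singleton]
    exact (Gal.toHom σ).homeomorph.isClosedMap _ hy
  · rw [Gal.toHom_mul, Gal.toHom_mul, ← Scheme.Hom.comp_apply,
      reassoc_of% Gal.toHom_comp_inv σ, Scheme.Hom.comp_apply, hgy]

instance normal_fixSubgroup : (fixSubgroup f).Normal := by
  refine ⟨fun g hg σ ↦ ?_⟩
  refine Subgroup.closure_induction (p := fun g _ ↦ σ * g * σ⁻¹ ∈ fixSubgroup f)
    (fun g hg ↦ Subgroup.subset_closure (HasFixedPoint.conj hg σ)) (by simp)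
    (fun x y _ _ hx hy ↦ ?_) (fun x _ hx ↦ ?_) hg
  · simpa [mul_assoc] using mul_mem hx hy
  · simpa [mul_assoc] using inv_mem hx

/-- If the quotient by `fixSubgroup f` is isomorphic to the base, then `fixSubgroup f` is
the whole group. -/
theorem fixSubgroup_eq_top_of_isIso [CompactSpace Y] [Nonempty Y] {M : Scheme.{u}} {χ : Y ⟶ M}
    (h : IsQuotientBy (fixSubgroup f) χ) {u : M ⟶ X} (hu : χ ≫ u = f) [IsIso u] :
    fixSubgroup f = ⊤ := by
  refine eq_top_iff.mpr fun σ _ ↦ ?_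
  obtain ⟨y, -, hy⟩ := IsClosed.exists_closed_singleton (isClosed_univ (X := Y)) Set.univ_nonempty
  -- Since `u` is an isomorphism, `χ` is invariant under every `σ`. Hence `σ y = i y` for some `i`
  -- in the subgroup, and `i⁻¹ σ` is itself a generator.
  have : Gal.toHom σ ≫ χ = χ := by
    rw [← cancel_mono u, Category.assoc, hu, Gal.toHom_comp]
  obtain ⟨i, hi, hiy⟩ := h.exists_of_eq y (Gal.toHom σ y) congr($this.symm y)
  have : HasFixedPoint (i⁻¹ * σ) := by
    refine ⟨y, hy, ?_⟩
    rw [Gal.toHom_mul, Scheme.Hom.comp_apply, ← hiy, ← Scheme.Hom.comp_apply,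
      Gal.toHom_comp_inv]
    rfl
  simpa using mul_mem hi (Subgroup.subset_closure this)

end Generators

/-! ### Normal schemes, function fields and the quotient by the full Galois group. -/

theorem isIso_of_bijective_app {N Y : Scheme.{u}} (D : N ⟶ Y) [IsAffineHom D]
    (h : ∀ y : Y, ∃ U : Y.Opens, y ∈ U ∧ IsAffineOpen U ∧ Function.Bijective (D.app U)) :
    IsIso D := by
  refine IsZariskiLocalAtTarget.of_forall_exists_morphismRestrict
    (P := MorphismProperty.isomorphisms Scheme) fun y ↦ ?_
  obtain ⟨U, hy, hU, hb⟩ := h y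
  exact ⟨U, hy, (isIso_morphismRestrict_iff_isIso_app D hU).mpr
    ((ConcreteCategory.isIso_iff_bijective _).mpr hb)⟩

section GenericPoint

variable {Y : Scheme.{u}} [IsIntegral Y]

/-- The inclusion of the generic point in an integral scheme. -/
noncomputable abbrev genericInclusion (Y : Scheme.{u}) [IsIntegral Y] :
    Spec Y.functionField ⟶ Y :=
  Y.fromSpecStalk (genericPoint Y)

theorem genericPoint_mem {U : Y.Opens} {y : Y} (hy : y ∈ U) : genericPoint Y ∈ U :=
  (genericPoint_specializes y).mem_open U.2 hy

instance : IsDominant (genericInclusion Y) := by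
  refine ⟨fun y ↦ ?_⟩
  rw [Scheme.range_fromSpecStalk]
  refine closure_mono (Set.singleton_subset_iff.mpr (specializes_refl (genericPoint Y))) ?_
  exact (genericPoint_specializes y).mem_closure

theorem genericInclusion_preimage {U : Y.Opens} (hU : genericPoint Y ∈ U) :
    genericInclusion Y ⁻¹ᵁ U = ⊤ :=
  Scheme.preimage_eq_top_of_closedPoint_mem _ (by rwa [Scheme.fromSpecStalk_closedPoint])

theorem genericInclusion_appLE {U : Y.Opens} (hU : genericPoint Y ∈ U) :
    (genericInclusion Y).appLE U ⊤ (genericInclusion_preimage hU).ge ≫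
      (Scheme.ΓSpecIso Y.functionField).hom = Y.presheaf.germ U (genericPoint Y) hU := by
  rw [Scheme.Hom.appLE, Scheme.fromSpecStalk_app hU, Category.assoc, Category.assoc,
    Category.assoc, ← Functor.map_comp_assoc]
  have : (homOfLE (le_top (a := genericInclusion Y ⁻¹ᵁ U))).op ≫ (homOfLE (genericInclusion_preimage hU).ge).op = 𝟙 _ := rfl
  rw [this]
  simp

theorem isIntegrallyClosed_of_isNormal (hY : IsNormal Y) {U : Y.Opens} (hU : IsAffineOpen U)
    [Nonempty U] : IsIntegrallyClosed Γ(Y, U) := by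
  refine IsIntegrallyClosed.of_localization_maximal fun p _ _ ↦ ?_
  let y := hU.fromSpec ⟨p, inferInstance⟩
  have hy : y ∈ U := by
    rw [← SetLike.mem_coe, ← hU.range_fromSpec]
    exact ⟨_, rfl⟩
  let := Y.presheaf.algebra_section_stalk ⟨y, hy⟩
  have h1 : IsLocalization.AtPrime (Y.presheaf.stalk y) p := hU.isLocalization_stalk' ⟨p, inferInstance⟩ hy
  have := (hY y).2
  exact IsIntegrallyClosed.of_equiv (IsLocalization.algEquiv p.primeCompl (Y.presheaf.stalk y) (Localization.AtPrime p)).toRingEquiv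

theorem exists_germ_eq_of_isIntegralElem (hY : IsNormal Y) {U : Y.Opens} (hU : IsAffineOpen U)
    (hη : genericPoint Y ∈ U) {x : Y.functionField}
    (hx : (Y.presheaf.germ U (genericPoint Y) hη).hom.IsIntegralElem x) :
    ∃ b, Y.presheaf.germ U (genericPoint Y) hη b = x := by
  have : Nonempty U := ⟨⟨_, hη⟩⟩
  have := isIntegrallyClosed_of_isNormal hY hU
  have := functionField_isFractionRing_of_isAffineOpen (X := Y) U hU
  exact IsIntegrallyClosed.isIntegral_iff.mp hx

/-- An integral birational morphism to a normal scheme is an isomorphism. -/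
theorem isIso_of_isIntegralHom (hY : IsNormal Y) {N : Scheme.{u}} [IsReduced N] (D : N ⟶ Y)
    [IsIntegralHom D] (j : Spec Y.functionField ⟶ N) [IsDominant j] [QuasiCompact j]
    (h : j ≫ D = genericInclusion Y) : IsIso D := by
  refine isIso_of_bijective_app D fun y ↦ ?_
  obtain ⟨_, ⟨U, hU, rfl⟩, hy, -⟩ :=
    Y.isBasis_affineOpens.exists_subset_of_mem_open (Set.mem_univ y) isOpen_univ
  refine ⟨U, hy, hU, ?_⟩
  have hη := genericPoint_mem hy
  have := IsSchemeTheoreticallyDominant.of_isDominant j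
  have hle : ⊤ ≤ j ⁻¹ᵁ D ⁻¹ᵁ U := by
    rw [← Scheme.Hom.comp_preimage, h, genericInclusion_preimage hη]
  let q : Γ(N, D ⁻¹ᵁ U) ⟶ Y.functionField :=
    j.appLE (D ⁻¹ᵁ U) ⊤ hle ≫ (Scheme.ΓSpecIso Y.functionField).hom
  -- Functions on the reduced scheme `N` embed in `k(Y)` because `j` is dominant. Being integral
  -- over `Γ(Y, U)`, they then lie in it by normality.
  have hq : Function.Injective q := by
    have : IsIso (homOfLE hle) := ⟨homOfLE le_top, rfl, rfl⟩
    have h1 : Function.Injective (j.app (D ⁻¹ᵁ U) ≫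
        ((Spec Y.functionField).presheaf.map (homOfLE hle).op ≫ (Scheme.ΓSpecIso _).hom)) :=
      ((ConcreteCategory.isIso_iff_bijective ((Spec Y.functionField).presheaf.map (homOfLE hle).op ≫
        (Scheme.ΓSpecIso _).hom)).mp inferInstance).1.comp (j.app_injective _)
    simpa only [q, Scheme.Hom.appLE, Category.assoc] using h1
  have hDq : D.app U ≫ q = Y.presheaf.germ U (genericPoint Y) hη := by
    rw [← genericInclusion_appLE hη, ← Category.assoc, Scheme.Hom.app_eq_appLE,
      Scheme.Hom.appLE_comp_appLE]
    simp only [h]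
  constructor
  · have : Function.Injective (D.app U ≫ q) := by
      rw [hDq]
      exact germ_injective_of_isIntegral _ _ _
    exact Function.Injective.of_comp (f := q) (by simpa using this)
  · intro t
    obtain ⟨p, hp, hpt⟩ := D.isIntegral_app U hU t
    obtain ⟨b, hb⟩ := exists_germ_eq_of_isIntegralElem hY hU hη (x := q t) ⟨p, hp, by
      rw [← hDq, CommRingCat.hom_comp, ← Polynomial.hom_eval₂, hpt, map_zero]⟩
    refine ⟨b, hq ?_⟩
    rw [← hb, ← hDq]
    rfl

theorem hom_ext_of_genericInclusion {X Z : Scheme.{u}} (s : Z ⟶ X) [IsSeparated s] {a b : Y ⟶ Z}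
    (h : a ≫ s = b ≫ s) (h' : genericInclusion Y ≫ a = genericInclusion Y ≫ b) : a = b :=
  ext_of_isDominant_of_isSeparated s h (genericInclusion Y) h'

/-- Over `X`, morphisms from the generic point of a normal scheme to itself extend. -/
theorem exists_extension_of_isNormal (hY : IsNormal Y) {X : Scheme.{u}} (f : Y ⟶ X)
    [IsIntegralHom f] (a : Spec Y.functionField ⟶ Y) (ha : a ≫ f = genericInclusion Y ≫ f) :
    ∃ g : Y ⟶ Y, g ≫ f = f ∧ genericInclusion Y ≫ g = a := by
  let q := genericInclusion Y ≫ f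
  -- The normalization of `X` in the generic point of `Y` is `Y` itself, by normality and
  -- integrality of `f`. Its universal property then extends `a`.
  let D : q.normalization ⟶ Y := q.normalizationDesc (genericInclusion Y) f rfl
  have : IsIntegralHom (D ≫ f) := by
    rw [Scheme.Hom.normalizationDesc_comp]
    infer_instance
  have : IsIntegralHom D := .of_comp D f
  have hD : q.toNormalization ≫ D = genericInclusion Y := q.toNormalization_normalizationDesc _ _ _
  have : IsIso D := isIso_of_isIntegralHom hY D q.toNormalization hD
  refine ⟨inv D ≫ q.normalizationDesc a f ha.symm, ?_, ?_⟩
  · rw [Category.assoc, IsIso.inv_comp_eq, Scheme.Hom.normalizationDesc_comp,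
      Scheme.Hom.normalizationDesc_comp]
  · refine congr($hD.symm ≫ _).trans ?_
    rw [Category.assoc, IsIso.hom_inv_id_assoc, Scheme.Hom.toNormalization_normalizationDesc]

/-- Links the two Galois actions: an invariant function on `Y` has a germ fixed by the corresponding
field automorphism. -/
theorem germ_pull {X : Scheme.{u}} {f : Y ⟶ X} {g : Gal f} {τ : Y.functionField ⟶ Y.functionField}
    (h : genericInclusion Y ≫ Gal.toHom g = Spec.map τ ≫ genericInclusion Y) {U : X.Opens}
    (hU : genericPoint Y ∈ f ⁻¹ᵁ U) :
    pull (Gal.toHom_comp g) U ≫ Y.presheaf.germ _ _ hU = Y.presheaf.germ _ _ hU ≫ τ := by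
  have h1 := Scheme.Hom.appLE_comp_appLE (genericInclusion Y) (Gal.toHom g) (f ⁻¹ᵁ U) (f ⁻¹ᵁ U) ⊤
    (preimage_le (Gal.toHom_comp g) U) (genericInclusion_preimage hU).ge
  have h2 := Scheme.Hom.appLE_comp_appLE (Spec.map τ) (genericInclusion Y) (f ⁻¹ᵁ U) ⊤ ⊤
    (genericInclusion_preimage hU).ge le_rfl
  have h3 : (Spec.map τ).appLE ⊤ ⊤ le_rfl ≫ (Scheme.ΓSpecIso _).hom = (Scheme.ΓSpecIso _).hom ≫ τ :=
    congr($(Scheme.Hom.appLE_eq_app (Spec.map τ)) ≫ _).trans (Scheme.ΓSpecIso_naturality τ)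
  rw [← genericInclusion_appLE hU, pull, reassoc_of% h1, Category.assoc, ← h3, reassoc_of% h2]
  simp only [h]

end GenericPoint

section Galois

variable {X Y : Scheme.{u}} [IsIntegral X] [IsIntegral Y] {f : Y ⟶ X}

theorem genericInclusion_comp [IsDominant f] :
    genericInclusion Y ≫ f = Spec.map (functionFieldMap f) ≫ genericInclusion X := by
  rw [functionFieldMap, Spec.map_comp, Category.assoc,
    Scheme.SpecMap_stalkSpecializes_fromSpecStalk, Scheme.SpecMap_stalkMap_fromSpecStalk]

theorem germ_functionFieldMap [IsDominant f] {U : X.Opens} (hU : genericPoint X ∈ U)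
    (hU' : genericPoint Y ∈ f ⁻¹ᵁ U) :
    X.presheaf.germ U _ hU ≫ functionFieldMap f = f.app U ≫ Y.presheaf.germ _ _ hU' := by
  rw [functionFieldMap, TopCat.Presheaf.germ_stalkSpecializes_assoc, Scheme.Hom.germ_stalkMap]

/-- If `Y` is normal and `f` is integral, automorphisms of the function field over that of `X`
extend to automorphisms of `Y` over `X`. -/
theorem exists_gal_of_functionField (hY : IsNormal Y) [IsDominant f] [IsIntegralHom f]
    (τ : Y.functionField ≅ Y.functionField)
    (hτ : functionFieldMap f ≫ τ.hom = functionFieldMap f) :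
    ∃ g : Gal f, genericInclusion Y ≫ Gal.toHom g = Spec.map τ.hom ≫ genericInclusion Y := by
  have hτ' : functionFieldMap f ≫ τ.inv = functionFieldMap f := by
    rw [← hτ, Category.assoc, Iso.hom_inv_id, Category.comp_id, hτ]
  obtain ⟨g, hg, hgi⟩ := exists_extension_of_isNormal hY f (Spec.map τ.hom ≫ genericInclusion Y)
    (by rw [Category.assoc, genericInclusion_comp, ← Spec.map_comp_assoc, hτ])
  obtain ⟨g', hg', hgi'⟩ := exists_extension_of_isNormal hY f (Spec.map τ.inv ≫ genericInclusion Y)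
    (by rw [Category.assoc, genericInclusion_comp, ← Spec.map_comp_assoc, hτ'])
  have h1 : g ≫ g' = 𝟙 Y := hom_ext_of_genericInclusion f (by simp [hg, hg']) (by
    rw [reassoc_of% hgi, hgi', ← Spec.map_comp_assoc, Iso.inv_hom_id, Spec.map_id,
      Category.id_comp, Category.comp_id])
  have h2 : g' ≫ g = 𝟙 Y := hom_ext_of_genericInclusion f (by simp [hg, hg']) (by
    rw [reassoc_of% hgi', hgi, ← Spec.map_comp_assoc, Iso.hom_inv_id, Spec.map_id,
      Category.id_comp, Category.comp_id])
  exact ⟨Over.isoMk ⟨g, g', h1, h2⟩ hg, hgi⟩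

/-- Normality of `Y` realizes every field automorphism on `Y`, so invariant functions lie in the
fixed field `k(X)`; normality of `X` then makes these integral elements functions on `X`. -/
theorem isQuotientBy_gal (hX : IsNormal X) (hY : IsNormal Y) (hf : IsFiniteGalois f)
    [Finite (Gal f)] : IsQuotientBy (f := f) ⊤ f := by
  have := hf.isFinite
  have := hf.isDominant
  have : Surjective f := surjective_of_isDominant_of_isClosed_range f f.isClosedMap.isClosed_range
  refine isQuotientBy_of_affineCover (fun g _ ↦ Gal.toHom_comp g) fun x ↦ ?_
  obtain ⟨_, ⟨U, hU, rfl⟩, hx, -⟩ :=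
    X.isBasis_affineOpens.exists_subset_of_mem_open (Set.mem_univ x) isOpen_univ
  have hη := genericPoint_mem hx
  have hη' : genericPoint Y ∈ f ⁻¹ᵁ U := (specializes_genericPoint f).mem_open U.2 hη
  have hgerm := germ_functionFieldMap hη hη'
  refine ⟨U, hx, hU, fun s t hst ↦ ?_, fun b hb ↦ ?_⟩
  · refine germ_injective_of_isIntegral _ _ hη ((functionFieldMap f).hom.injective ?_)
    exact congr($hgerm s).trans (congr(Y.presheaf.germ _ _ hη' $hst).trans congr($hgerm t).symm)
  · let := (functionFieldMap f).hom.toAlgebra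
    have := hf.isGalois
    obtain ⟨x, hx⟩ : Y.presheaf.germ _ _ hη' b ∈
        Set.range (algebraMap X.functionField Y.functionField) := by
      rw [InfiniteGalois.mem_range_algebraMap_iff_fixed]
      intro τ
      obtain ⟨g, hg⟩ := exists_gal_of_functionField hY (f := f) τ.toRingEquiv.toCommRingCatIso
        (by ext a; exact τ.commutes a)
      exact congr($(germ_pull hg hη') b).symm.trans
        congr(Y.presheaf.germ _ _ hη' $(hb g trivial))
    change functionFieldMap f x = _ at hx
    obtain ⟨p, hp, hpb⟩ := f.isIntegral_app U hU b
    obtain ⟨a, ha⟩ := exists_germ_eq_of_isIntegralElem hX hU hη (x := x) ⟨p, hp, by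
      refine (functionFieldMap f).hom.injective ?_
      rw [Polynomial.hom_eval₂, ← CommRingCat.hom_comp, hgerm]
      erw [hx]
      rw [CommRingCat.hom_comp, ← Polynomial.hom_eval₂, hpb, map_zero, map_zero]⟩
    refine ⟨a, germ_injective_of_isIntegral _ _ hη' ?_⟩
    rw [← hx, ← ha]
    exact congr($hgerm a).symm

end Galois

/-! ### Finiteness of the automorphism group. -/

section FiniteGal

/-- An endomorphism is determined on finitely many generators, and it sends each to a root in the
domain `B` of a fixed monic polynomial. -/
theorem finite_algHom_of_moduleFinite (A B : Type*) [CommRing A] [CommRing B] [Algebra A B]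
    [Module.Finite A B] [IsDomain B] : Finite (B →ₐ[A] B) := by
  obtain ⟨s, hs⟩ := (inferInstance : Algebra.FiniteType A B).out
  choose p hp using fun b : B ↦ Algebra.IsIntegral.isIntegral (R := A) b
  have h0 (b : B) : (p b).map (algebraMap A B) ≠ 0 := ((hp b).1.map _).ne_zero
  let r (b : B) : Set B := {x | ((p b).map (algebraMap A B)).IsRoot x}
  have (b : B) : Finite (r b) := Polynomial.finite_setOfPred_isRoot (h0 b)
  refine Finite.of_injective (β := ∀ b : s, r b) (fun φ b ↦ ⟨φ b, ?_⟩) fun φ ψ h ↦ ?_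
  · have := congr(φ $((hp b).2))
    rw [map_zero, ← AlgHom.coe_toRingHom, Polynomial.hom_eval₂] at this
    simpa [r, Polynomial.eval_map] using this
  · refine AlgHom.ext_of_adjoin_eq_top hs fun b hb ↦ ?_
    exact congr(($h ⟨b, hb⟩).1)

/-- Automorphisms over `X` are determined on the dense affine preimage of an affine open, where they
are algebra endomorphisms of a finite algebra. -/
theorem finite_gal {X Y : Scheme.{u}} [IsIntegral Y] (f : Y ⟶ X) [IsFinite f] :
    Finite (Gal f) := by
  obtain ⟨_, ⟨U, hU, rfl⟩, hη, -⟩ := X.isBasis_affineOpens.exists_subset_of_mem_open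
    (Set.mem_univ (f (genericPoint Y))) isOpen_univ
  have hV := hU.preimage f
  have : Nonempty (f ⁻¹ᵁ U) := ⟨⟨_, hη⟩⟩
  let : Algebra Γ(X, U) Γ(Y, f ⁻¹ᵁ U) := (f.app U).hom.toAlgebra
  have : Module.Finite Γ(X, U) Γ(Y, f ⁻¹ᵁ U) := f.finite_app U hU
  have := finite_algHom_of_moduleFinite Γ(X, U) Γ(Y, f ⁻¹ᵁ U)
  have : IsDominant hV.fromSpec := by
    refine ⟨?_⟩
    rw [DenseRange, hV.range_fromSpec]
    exact (f ⁻¹ᵁ U).2.dense ⟨_, hη⟩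
  let φ (g : Gal f) : Γ(Y, f ⁻¹ᵁ U) →ₐ[Γ(X, U)] Γ(Y, f ⁻¹ᵁ U) :=
    { (pull (Gal.toHom_comp g) U).hom with
      commutes' := fun a ↦ pull_app_apply (Gal.toHom_comp g) U a }
  refine Finite.of_injective φ fun g h e ↦ Gal.ext_toHom ?_
  refine ext_of_isDominant_of_isSeparated f (by simp) hV.fromSpec ?_
  have : pull (Gal.toHom_comp g) U = pull (Gal.toHom_comp h) U := by
    ext b
    exact congr($e b)
  rw [fromSpec_toHom, fromSpec_toHom, this]

end FiniteGal

/-! ### Rigidity of lifts along étale maps. -/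

section Rigidity

open Limits

/-- Two lifts of a morphism along a separated unramified morphism which agree at a point of an
integral scheme are equal. -/
theorem eq_of_unramified {Y Z X M : Scheme.{u}} [IsIntegral Y] [Nonempty Z] (p : Z ⟶ Y)
    (u : X ⟶ M) [IsSeparated u] [FormallyUnramified u] [LocallyOfFiniteType u] {a b : Y ⟶ X}
    (h : a ≫ u = b ≫ u) (hp : p ≫ a = p ≫ b) : a = b := by
  let s : Y ⟶ pullback u u := pullback.lift a b h
  have hs1 : s ≫ pullback.fst u u = a := pullback.lift_fst a b h
  have hs2 : s ≫ pullback.snd u u = b := pullback.lift_snd a b h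
  -- The diagonal of an unramified morphism is an open immersion, so the two lifts agree on an open
  -- set. It is nonempty by `hp`, hence dense, and separatedness concludes.
  let W : Y.Opens := s ⁻¹ᵁ (pullback.diagonal u).opensRange
  have hps : p ≫ s = (p ≫ a) ≫ pullback.diagonal u := by
    apply pullback.hom_ext <;> simp [hs1, hs2, hp]
  have hW : (W : Set Y).Nonempty := by
    obtain ⟨z⟩ := (inferInstance : Nonempty Z)
    exact ⟨p z, (p ≫ a) z, congr($hps.symm z)⟩
  have : IsDominant W.ι := Opens.isDominant_ι (W.2.dense hW)
  refine ext_of_isDominant_of_isSeparated u h W.ι ?_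
  let t := IsOpenImmersion.lift (pullback.diagonal u) (W.ι ≫ s) (by
    rintro _ ⟨w, rfl⟩
    exact w.2)
  have ht : t ≫ pullback.diagonal u = W.ι ≫ s := IsOpenImmersion.lift_fac _ _ _
  have h1 : t = W.ι ≫ a := by simpa [hs1] using congr($ht ≫ pullback.fst u u)
  have h2 : t = W.ι ≫ b := by simpa [hs2] using congr($ht ≫ pullback.snd u u)
  rw [← h1, ← h2]

/-- A separated étale morphism to a non-empty scheme from an integral scheme is an isomorphism as
soon as it has a section. -/
theorem isIso_of_etale_of_section {X M : Scheme.{u}} [Nonempty M] [IsIntegral X] (u : X ⟶ M)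
    [Etale u] [IsSeparated u] (s : M ⟶ X) (h : s ≫ u = 𝟙 M) : IsIso u := by
  have : IsClosedImmersion (s ≫ u) := by rw [h]; infer_instance
  have : IsClosedImmersion s := .of_comp s u
  have : Etale (s ≫ u) := by rw [h]; infer_instance
  have : Etale s := .of_comp s u
  -- The section is closed because `u` is separated and open because it is étale; its image is
  -- therefore all of the irreducible `X`.
  have hcl : IsClopen (Set.range s) :=
    ⟨s.isClosedEmbedding.isClosed_range, s.isOpenMap.isOpen_range⟩
  have : Surjective s := ⟨Set.range_eq_univ.mp (hcl.eq_univ (Set.range_nonempty s))⟩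
  have : IsIso s := isIso_of_isClosedImmersion_of_surjective s
  rw [← (IsIso.inv_eq_of_hom_inv_id h)]
  infer_instance

variable {k : Type u} [Field k] [IsAlgClosed k] {X Y : Scheme.{u}} {f : Y ⟶ X}
  (pX : X ⟶ Spec (CommRingCat.of k))

/-- Rigidity needs agreement as morphisms, not only on underlying points. Over an algebraically
closed field a closed point is a `k`-point, and a `k`-point is determined by its image. -/
theorem HasFixedPoint.exists_point [LocallyOfFiniteType (f ≫ pX)] {g : Gal f}
    (hg : HasFixedPoint g) : ∃ p : Spec (CommRingCat.of k) ⟶ Y, p ≫ Gal.toHom g = p := by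
  obtain ⟨y, hy, hgy⟩ := hg
  refine ⟨pointOfClosedPoint (f ≫ pX) y hy, ext_of_apply_closedPoint_eq (f ≫ pX) ?_ ?_ ?_⟩
  · rw [Category.assoc, reassoc_of% Gal.toHom_comp g, pointOfClosedPoint_comp]
  · rw [pointOfClosedPoint_comp]
  · exact (congr_arg (Gal.toHom g) (pointOfClosedPoint_apply _ y hy _)).trans
      (hgy.trans (pointOfClosedPoint_apply _ y hy _).symm)

/-- The quotient by the subgroup generated by the automorphisms with a fixed point does not factor
through a non-trivial étale covering. -/
theorem isIso_of_isQuotientBy_fixSubgroup [LocallyOfFiniteType (f ≫ pX)] [IsIntegral Y]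
    {M X' : Scheme.{u}} [IsIntegral X'] {χ : Y ⟶ M} (h : IsQuotientBy (fixSubgroup f) χ)
    (g : Y ⟶ X') (u : X' ⟶ M) [IsSeparated u] [Etale u] (hu : g ≫ u = χ) : IsIso u := by
  -- For a generator `σ`, both sides lift `χ` along `u` and agree at a fixed `k`-point, so rigidity
  -- applies. The invariant `g` then descends to a section of `u`.
  have hg : ∀ σ ∈ fixSubgroup f, Gal.toHom σ ≫ g = g := by
    intro σ hσ
    refine Subgroup.closure_induction (p := fun σ _ ↦ Gal.toHom σ ≫ g = g) (fun σ hσ ↦ ?_)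
      ?_ (fun σ τ _ _ hσ hτ ↦ ?_) (fun σ _ hσ ↦ ?_) hσ
    · obtain ⟨p, hp⟩ := HasFixedPoint.exists_point pX hσ
      refine eq_of_unramified p u ?_ (by rw [reassoc_of% hp])
      rw [Category.assoc, hu, h.invariant σ (Subgroup.subset_closure hσ)]
    · rw [Gal.toHom_one, Category.id_comp]
    · rw [Gal.toHom_mul, Category.assoc, hσ, hτ]
    · rw [← hσ, ← Category.assoc, Gal.toHom_inv_comp, Category.id_comp, hσ]
  obtain ⟨s, hs⟩ := h.exists_desc g hg
  have : Nonempty M := ⟨χ (genericPoint Y)⟩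
  refine isIso_of_etale_of_section u s (h.hom_ext ?_)
  rw [reassoc_of% hs, hu, Category.comp_id]

end Rigidity

/-! ### Generic étaleness from separability of the function fields. -/

section GenericallyEtale

variable {X Y : Scheme.{u}}

theorem etale_morphismRestrict_iff (f : Y ⟶ X) (U : X.Opens) :
    Etale (f ∣_ U) ↔ Etale ((f ⁻¹ᵁ U).ι ≫ f) := by
  rw [← morphismRestrict_ι]
  refine ⟨fun _ ↦ inferInstance, fun _ ↦ .of_comp _ U.ι⟩

/-- `A → K` is a localization and `K → L` is separable, so `L`, the local ring of `B` at the zero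
ideal, is formally étale over `A`. Étaleness at a prime spreads out to a basic open. -/
theorem exists_etale_localization (A B K L : Type u) [CommRing A] [CommRing B] [Field K] [Field L]
    [Algebra A B] [Algebra A K] [Algebra A L] [Algebra B L] [Algebra K L] [IsDomain A] [IsDomain B]
    [IsScalarTower A B L] [IsScalarTower A K L] [IsFractionRing A K] [IsFractionRing B L]
    [Algebra.FinitePresentation A B] [Algebra.IsSeparable K L] :
    ∃ b : B, b ≠ 0 ∧ Algebra.Etale A (Localization.Away b) := by
  have : Algebra.FormallyEtale A K := .of_isLocalization (nonZeroDivisors A)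
  have : Algebra.FormallyEtale K L := .of_isSeparable K L
  have : Algebra.FormallyEtale A L := .comp A K L
  have : IsLocalization.AtPrime L (⊥ : Ideal B) := by
    rw [IsLocalization.AtPrime, Ideal.primeCompl_bot]
    infer_instance
  have : Algebra.IsEtaleAt A (⊥ : Ideal B) := .of_equiv
    ((IsLocalization.algEquiv (⊥ : Ideal B).primeCompl L
      (Localization.AtPrime (⊥ : Ideal B))).restrictScalars A)
  exact Algebra.exists_etale_of_isEtaleAt (⊥ : Ideal B)

theorem etale_fromSpec_comp (f : Y ⟶ X) {U : X.Opens} (hU : IsAffineOpen U) {W : Y.Opens}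
    (hW : IsAffineOpen W) (e : W ≤ f ⁻¹ᵁ U) (h : (f.appLE U W e).hom.Etale) : Etale (W.ι ≫ f) := by
  have : Etale (Spec.map (f.appLE U W e)) := HasRingHomProperty.Spec_iff.mpr h
  rw [← hW.isoSpec_hom_fromSpec]
  rw [Category.assoc, ← IsAffineOpen.SpecMap_appLE_fromSpec _ hU hW e]
  infer_instance

theorem exists_etale_morphismRestrict [IsIntegral X] [IsIntegral Y] [IsLocallyNoetherian X]
    {f : Y ⟶ X} (hf : IsFiniteGalois f) :
    ∃ U : X.Opens, (U : Set X).Nonempty ∧ Etale (f ∣_ U) := by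
  have := hf.isFinite
  have := hf.isDominant
  obtain ⟨_, ⟨U, hU, rfl⟩, hη, -⟩ := X.isBasis_affineOpens.exists_subset_of_mem_open
    (Set.mem_univ (genericPoint X)) isOpen_univ
  have hη' : genericPoint Y ∈ f ⁻¹ᵁ U := (specializes_genericPoint f).mem_open U.2 hη
  have hV := hU.preimage f
  have : Nonempty U := ⟨⟨_, hη⟩⟩
  have : Nonempty (f ⁻¹ᵁ U) := ⟨⟨_, hη'⟩⟩
  let A := Γ(X, U)
  let B := Γ(Y, f ⁻¹ᵁ U)
  let : Algebra A B := (f.app U).hom.toAlgebra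
  have : Module.Finite A B := f.finite_app U hU
  have := functionField_isFractionRing_of_isAffineOpen (X := X) U hU
  have := functionField_isFractionRing_of_isAffineOpen (X := Y) _ hV
  let : Algebra X.functionField Y.functionField := (functionFieldMap f).hom.toAlgebra
  have := hf.isGalois
  let : Algebra A Y.functionField := ((algebraMap B Y.functionField).comp (algebraMap A B)).toAlgebra
  have : IsScalarTower A B Y.functionField := .of_algebraMap_eq' rfl
  have : IsScalarTower A X.functionField Y.functionField := .of_algebraMap_eq' <| by
    exact congr(($(germ_functionFieldMap hη hη')).hom).symm
  have : IsNoetherianRing A := IsLocallyNoetherian.component_noetherian ⟨U, hU⟩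
  have : Algebra.FinitePresentation A B :=
    Algebra.FinitePresentation.of_finiteType.mp inferInstance
  obtain ⟨b, hb, hbe⟩ := exists_etale_localization A B X.functionField Y.functionField
  let W := Y.basicOpen b
  have hWe : Etale (W.ι ≫ f) := by
    refine etale_fromSpec_comp f hU (hV.basicOpen b) (Y.basicOpen_le b) ?_
    have := hV.isLocalization_basicOpen b
    let : Algebra A Γ(Y, Y.basicOpen b) := (f.appLE U _ (Y.basicOpen_le b)).hom.toAlgebra
    have : IsScalarTower A B Γ(Y, Y.basicOpen b) := .of_algebraMap_eq' rfl
    exact Algebra.Etale.of_equiv ((IsLocalization.algEquiv (Submonoid.powers b)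
      (Localization.Away b) Γ(Y, Y.basicOpen b)).restrictScalars A)
  -- The étale locus found so far is open in `Y`, while an open subset of `X` is wanted. As `b` is
  -- nonzero and integral over `A`, it has a nonzero multiple `a` in `A`, whose basic open pulls
  -- back into that of `b`.
  obtain ⟨a, ha, ha0⟩ := Submodule.exists_mem_ne_zero_of_ne_bot
    (Ideal.comap_ne_bot_of_integral_mem (R := A) hb (Ideal.mem_span_singleton_self b)
      (Algebra.IsIntegral.isIntegral b))
  obtain ⟨c, hc⟩ := Ideal.mem_span_singleton.mp (Ideal.mem_comap.mp ha)
  have hle : f ⁻¹ᵁ X.basicOpen a ≤ W := by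
    rw [Scheme.preimage_basicOpen, show f.app U a = b * c from hc, Scheme.basicOpen_mul]
    exact inf_le_left
  refine ⟨X.basicOpen a, ?_, ?_⟩
  · exact Set.nonempty_iff_ne_empty.mpr fun h ↦
      ha0 ((basicOpen_eq_bot_iff a).mp (SetLike.coe_injective h))
  · rw [etale_morphismRestrict_iff, ← Scheme.homOfLE_ι _ hle, Category.assoc]
    infer_instance

end GenericallyEtale

/-! ### Arbitrary quotients by the subgroup. -/

section QuotientByFixSubgroup

variable {X Y M : Scheme.{u}} {f : Y ⟶ X} {χ : Y ⟶ M}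

theorem IsQuotientBy.isIntegral [IsIntegral Y] {H : Subgroup (Gal f)} (h : IsQuotientBy H χ) :
    IsIntegral M := by
  have : IsReduced M := ⟨fun U ↦ isReduced_of_injective (χ.app U).hom (h.app_injective U)⟩
  have : IrreducibleSpace M := by
    rw [irreducibleSpace_def, Set.top_eq_univ, ← h.isQuotientMap.surjective.range_eq,
      ← Set.image_univ]
    exact (IrreducibleSpace.isIrreducible_univ Y).image _ χ.continuous.continuousOn
  exact isIntegral_of_irreducibleSpace_of_isReduced M

/-- Two quotients by the same group are isomorphic. -/
theorem IsQuotientBy.exists_iso {H : Subgroup (Gal f)} (h : IsQuotientBy H χ) {M' : Scheme.{u}}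
    {χ' : Y ⟶ M'} (h' : IsQuotientBy H χ') : ∃ e : M ≅ M', χ ≫ e.hom = χ' := by
  obtain ⟨a, ha⟩ := h.exists_desc χ' h'.invariant
  obtain ⟨b, hb⟩ := h'.exists_desc χ h.invariant
  exact ⟨⟨a, b, h.hom_ext (by rw [reassoc_of% ha, hb, Category.comp_id]),
    h'.hom_ext (by rw [reassoc_of% hb, ha, Category.comp_id])⟩, ha⟩

/-- Both properties are known for the constructed quotient and carry over by uniqueness of
quotients. -/
theorem etale_and_isAffineHom_of_isQuotientBy [IsIntegralHom f] [Finite (Gal f)] [JacobsonSpace Y]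
    (hf : IsQuotientBy (f := f) ⊤ f) (h : IsQuotientBy (fixSubgroup f) χ) {u : M ⟶ X}
    (hu : χ ≫ u = f) : Etale u ∧ IsAffineHom u := by
  have := etale_quotientToBase (fixSubgroup f) hf fun g hg ↦ Subgroup.subset_closure hg
  obtain ⟨e, he⟩ := h.exists_iso (isQuotientBy_toQuotient (fixSubgroup f))
  have : u = e.hom ≫ quotientToBase (fixSubgroup f) :=
    h.hom_ext (by rw [reassoc_of% he, toQuotient_toBase, hu])
  subst this
  exact ⟨inferInstance, inferInstance⟩

/-- Étaleness cancels: if `u` and a restriction of `χ ≫ u` are étale, so is the restriction of `χ`.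
-/
theorem exists_etale_morphismRestrict_of_comp (χ : Y ⟶ M) (u : M ⟶ X) [Etale u] [Surjective (χ ≫ u)]
    (h : ∃ U : X.Opens, (U : Set X).Nonempty ∧ Etale ((χ ≫ u) ∣_ U)) :
    ∃ U : M.Opens, (U : Set M).Nonempty ∧ Etale (χ ∣_ U) := by
  obtain ⟨U, ⟨x, hx⟩, hU⟩ := h
  obtain ⟨y, rfl⟩ := (χ ≫ u).surjective x
  refine ⟨u ⁻¹ᵁ U, ⟨χ y, hx⟩, ?_⟩
  rw [etale_morphismRestrict_iff] at hU ⊢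
  have : Etale (((χ ⁻¹ᵁ u ⁻¹ᵁ U).ι ≫ χ) ≫ u) := by rwa [Category.assoc]
  exact .of_comp _ u

end QuotientByFixSubgroup

end QuotVar

/-! ### The three claims assembled. -/

theorem lemma03p11 {k : Type u} [Field k] [IsAlgClosed k] {X Y : Scheme.{u}}
    (pX : X ⟶ Spec (CommRingCat.of k)) (pY : Y ⟶ Spec (CommRingCat.of k))
    (hX : QuotVar.IsVariety pX) (hY : QuotVar.IsVariety pY)
    (hXn : QuotVar.IsNormal X) (hYn : QuotVar.IsNormal Y)
    (f : Y ⟶ X) (hfk : f ≫ pX = pY) (hf : QuotVar.IsFiniteGalois f) :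
    (QuotVar.fixSubgroup f = ⊤ → QuotVar.IsGenuinelyRamified pX f) ∧
    ((QuotVar.fixSubgroup f).Normal ∧
      (∃ (M : Scheme.{u}) (χ : Y ⟶ M), QuotVar.IsQuotientBy (QuotVar.fixSubgroup f) χ) ∧
      ∀ (M : Scheme.{u}) (χ : Y ⟶ M), QuotVar.IsQuotientBy (QuotVar.fixSubgroup f) χ →
        (∃! u : M ⟶ X, χ ≫ u = f) ∧
        ∀ u : M ⟶ X, χ ≫ u = f →
          QuotVar.IsVariety (u ≫ pX) ∧ QuotVar.IsGenuinelyRamified (u ≫ pX) χ ∧ Etale u) ∧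
    (QuotVar.IsGenuinelyRamified pX f → QuotVar.fixSubgroup f = ⊤) := by
  have := hX.isIntegral
  have := hX.locallyOfFiniteType
  have := hX.quasiCompact
  have := hY.isIntegral
  have := hf.isFinite
  have := hf.isDominant
  have : LocallyOfFiniteType (f ≫ pX) := hfk ▸ hY.locallyOfFiniteType
  have := hY.quasiCompact
  have : CompactSpace Y := QuasiCompact.compactSpace_of_compactSpace pY
  have : JacobsonSpace Y := LocallyOfFiniteType.jacobsonSpace (f ≫ pX)
  have : IsLocallyNoetherian X := LocallyOfFiniteType.isLocallyNoetherian pX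
  have := QuotVar.finite_gal f
  have hq := QuotVar.isQuotientBy_gal hXn hYn hf
  obtain ⟨U, hU, hUe⟩ := QuotVar.exists_etale_morphismRestrict hf
  have hquot {M : Scheme.{u}} {χ : Y ⟶ M} (h : QuotVar.IsQuotientBy (QuotVar.fixSubgroup f) χ)
      (u : M ⟶ X) (hu : χ ≫ u = f) :
      Etale u ∧ IsAffineHom u ∧ QuotVar.IsVariety (u ≫ pX) := by
    have ⟨h1, h2⟩ := QuotVar.etale_and_isAffineHom_of_isQuotientBy hq h hu
    have := h.isIntegral
    exact ⟨h1, h2, ⟨inferInstance, inferInstance, inferInstance⟩⟩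
  have hram {M : Scheme.{u}} {χ : Y ⟶ M} (h : QuotVar.IsQuotientBy (QuotVar.fixSubgroup f) χ)
      (u : M ⟶ X) (hu : χ ≫ u = f) : QuotVar.IsGenuinelyRamified (u ≫ pX) χ := by
    obtain ⟨_, _, _⟩ := hquot h u hu
    have : Surjective χ := ⟨h.isQuotientMap.surjective⟩
    have : IsFinite (χ ≫ u) := hu ▸ inferInstance
    have : Surjective (χ ≫ u) := ⟨hu ▸ hq.isQuotientMap.surjective⟩
    refine ⟨.of_comp χ u, inferInstance,
      QuotVar.exists_etale_morphismRestrict_of_comp χ u ⟨U, hU, hu ▸ hUe⟩, ?_⟩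
    intro X' g v hX' _ _ hv
    have := hX'.isIntegral
    exact QuotVar.isIso_of_isQuotientBy_fixSubgroup pX h g v hv
  refine ⟨fun hI ↦ ?_, ⟨inferInstance, ⟨_, _, QuotVar.isQuotientBy_toQuotient _⟩, ?_⟩, ?_⟩
  -- Now `f` itself is a quotient by the subgroup, so the second claim's ramification statement
  -- applies with `u` the identity.
  · rw [← hI] at hq
    simpa using hram hq (𝟙 X) (Category.comp_id f)
  · intro M χ h
    obtain ⟨u, hu⟩ := h.exists_desc f fun g _ ↦ QuotVar.Gal.toHom_comp g
    refine ⟨⟨u, hu, fun v hv ↦ h.hom_ext (hv.trans hu.symm)⟩, fun v hv ↦ ?_⟩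
    exact ⟨(hquot h v hv).2.2, hram h v hv, (hquot h v hv).1⟩
  · intro hram
    have h := QuotVar.isQuotientBy_toQuotient (QuotVar.fixSubgroup f)
    have hu := QuotVar.toQuotient_toBase (QuotVar.fixSubgroup f)
    obtain ⟨_, _, hvar⟩ := hquot h _ hu
    -- The quotient is affine, hence separated, and étale over `X`, so it is an admissible
    -- factorization of `f`.
    have := hram.isIso_of_factorization _ _ _ hvar inferInstance inferInstance hu
    exact QuotVar.fixSubgroup_eq_top_of_isIso h hu
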